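/- Let $d\ge 1$, $T\ge 2$ be integers, let $\beta\ge 2$, $L>0$, $\alpha>0$, $G>2\alpha$, and let $\Theta=\{x\in\mathbb R^d:\|x\|\le 1\}$ (Euclidean norm). Let $\ell$ be the greatest integer strictly less than $\beta$. Let $\mathcal F'_{\alpha,\beta}$ be the set of functions $f:\mathbb R^d\to\mathbb R$ such that (i) $f$ is $\ell$ times differentiable and $\bigl|f(z)-\sum_{0\le|m|\le\ell}\frac1{m!}D^mf(x)(z-x)^m\bigr|\le L\|z-x\|^\beta$ for all $x,z\in\Theta$; (ii) $f$ is $\alpha$-strongly convex: $f(y)\ge f(x)+\langle\nabla f(x),y-x\rangle+\frac\alpha2\|x-y\|^2$ for all $x,y\in\mathbb R^d$; (iii) $\max_{x\in\Theta}\|\nabla f(x)\|\le G$; (iv) $f$ attains its minimum over $\mathbb R^d$ at a point of $\Theta$; this point, the minimizer of $f$ on $\Theta$, is denoted by $x^*(f)$. If $\beta=2$, assume moreover that $\alpha\le\kappa L$ for a fixed number $\kappa<2$. Let $\xi_1,\dots,\xi_T$ be independent real random variables with common distribution function $F$ such that, for some $0<I_0<\infty$ and $0<v_0\le\infty$, $$\int\log\bigl(dF(u)/dF(u+v)\bigr)\,dF(u)\le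 I_0v^2\qquad\text{whenever } |v|<v_0 .$$ A sequential strategy consists of a random variable $z_1\in\mathbb R^d$ independent of $(\xi_1,\dots,\xi_T)$ and of Borel functions $\Phi_2,\dots,\Phi_T$; for the objective $f$ it observes $y_t=f(z_t)+\xi_t$, and its query points are $z_t=\Phi_t(z_1,\dots,z_{t-1},y_1,\dots,y_{t-1})$ for $t=2,\dots,T$. Then there is a constant $C>0$, depending only on $\beta,L,G,I_0,v_0$ and (if $\beta=2$) $\kappa$, and in particular not on $T$, $d$ and $\alpha$, such that every sequential strategy satisfies $$\sup_{f\in\mathcal F'_{\alpha,\beta}}\mathbb E\bigl[f(z_T)-\min_xf(x)\bigr]\ \ge\ C\min\Bigl(\max(\alpha,T^{-1/2+1/\beta}),\ \frac d{\sqrt T},\ \frac d\alpha T^{-\frac{\beta-1}\beta}\Bigr)$$ and $$\sup_{f\in\mathcal F'_{\alpha,\beta}}\mathbb E\bigl[\|z_T-x^*(f)\|^2\bigr]\ \ge\ C\min\Bigl(1,\ \frac d{T^{1/\beta}},\ \frac d{\alpha^2}T^{-\frac{\beta-1}\beta}\Bigr).$$ -/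

import Mathlib

open MeasureTheory ProbabilityTheory
open scoped ENNReal

namespace ZeroOrder

/-- The space `ℝ^d` with its Euclidean norm. -/
abbrev E (d : ℕ) : Type := EuclideanSpace ℝ (Fin d)

/-- The constraint set: the closed Euclidean unit ball of `ℝ^d`. -/
def unitBall (d : ℕ) : Set (E d) := Metric.closedBall 0 1

/-- The greatest integer strictly less than `β` (for `β > 0`). -/
noncomputable def holderOrder (β : ℝ) : ℕ := ⌈β⌉₊ - 1

/-- The Taylor polynomial of order `n` of `f` at `x`, evaluated at `z`. The `k`-th summand is the
sum of `D^m f(x) (z - x)^m / m!` over the multi-indices `m` with `|m| = k`. -/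
noncomputable def taylorPoly {d : ℕ} (f : E d → ℝ) (n : ℕ) (x z : E d) : ℝ :=
  ∑ k ∈ Finset.range (n + 1), ((k.factorial : ℝ))⁻¹ * iteratedFDeriv ℝ k f x (fun _ => z - x)

/-- The class of functions on `ℝ^d` that are `ℓ` times differentiable, `ℓ` being the greatest
integer strictly less than `β`, and satisfy the Hölder type condition with exponent `β` and
constant `L` on the unit ball. -/
def holderClass (d : ℕ) (β L : ℝ) : Set (E d → ℝ) :=
  {f | (∀ k < holderOrder β, Differentiable ℝ (iteratedFDeriv ℝ k f)) ∧
    ∀ x ∈ unitBall d, ∀ z ∈ unitBall d,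
      |f z - taylorPoly f (holderOrder β) x z| ≤ L * ‖z - x‖ ^ β}

/-- `α`-strong convexity on `ℝ^d` of a differentiable function. -/
def IsStronglyConvex {d : ℕ} (α : ℝ) (f : E d → ℝ) : Prop :=
  ∀ x y : E d, f x + inner ℝ (gradient f x) (y - x) + α / 2 * ‖x - y‖ ^ 2 ≤ f y

/-- The class over which the worst case is taken: `α`-strongly convex functions of the `β`-Hölder
class, with gradient bounded by `G` on the unit ball, that attain their minimum over `ℝ^d` at a
point of the unit ball. -/
def targetClass (d : ℕ) (α β L G : ℝ) : Set (E d → ℝ) :=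
  {f | f ∈ holderClass d β L ∧ IsStronglyConvex α f ∧
    (∀ x ∈ unitBall d, ‖gradient f x‖ ≤ G) ∧
    ∃ x ∈ unitBall d, ∀ y : E d, f x ≤ f y}

/-- The minimizer of `f` on the unit ball (it exists and is unique for `f` in the target class). -/
noncomputable def minimizer {d : ℕ} (f : E d → ℝ) : E d :=
  Classical.epsilon fun x => x ∈ unitBall d ∧ IsMinOn f (unitBall d) x

/-- A sequential search strategy: the Borel maps that give the next query point when `t` query
points and the `t` corresponding observations are already known. (The map for `t = 0` is not used:
the first query point is a random variable.) -/
structure Strategy (d : ℕ) where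
  next : (t : ℕ) → (Fin t → E d) × (Fin t → ℝ) → E d
  measurable_next : ∀ t, Measurable (next t)

/-- The query points when the objective is `f`, the first query point is `z₁` and the noises are
`e 0, e 1, …`; the observation at the query point number `s` is `f (query s) + e s`. Counting starts
at `0`, so that the `T`-th query point is `query (T - 1)`. -/
noncomputable def query {d : ℕ} (S : Strategy d) (f : E d → ℝ) (z₁ : E d) (e : ℕ → ℝ) : ℕ → E d
  | 0 => z₁
  | t + 1 => S.next (t + 1)
      (fun s : Fin (t + 1) => query S f z₁ e s,
       fun s : Fin (t + 1) => f (query S f z₁ e s) + e s)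
termination_by t => t
decreasing_by all_goals exact s.isLt

/-- The condition `∫ log (dF(u) / dF(u + v)) dF(u) ≤ I₀ v²` for `|v| < v₀` on the noise
distribution `ν` (with distribution function `F`). The measure `dF(u + v)` is the image of `ν` under
`u ↦ u - v`, and the integral is a Kullback-Leibler divergence. -/
def NoiseCondition (ν : Measure ℝ) (I₀ : ℝ) (v₀ : ℝ≥0∞) : Prop :=
  ∀ v : ℝ, ENNReal.ofReal |v| < v₀ →
    InformationTheory.klDiv ν (ν.map fun u => u - v) ≤ ENNReal.ofReal (I₀ * v ^ 2)

end ZeroOrder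

namespace ZeroOrder

/-! The proof is an Assouad argument over `2 ^ d` functions `hardFun`: in each coordinate, a
parabola of curvature `A` plus or minus a wave `c * sin (s / h)`. The sign moves the minimizer to
`∓u` in that coordinate, with `u` of order `c / (h * A)`. Flipping one sign changes the function by
at most `2 * c` everywhere on `ℝ^d`, so `NoiseCondition` bounds the information per observation by
`I₀ * (2 * c) ^ 2`, wherever the strategy queries.

With `c = ρ * h ^ β` the wave has a Hölder constant of order `ρ`, and `T` observations carry bounded
information as long as `h ^ (2 * β) ≤ 1 / T`. Each sign is then misjudged with constant probability
on average over the two alternatives, whence some function has squared error of order `d * u ^ 2`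
(`exists_hardFun_le_lintegral`). Strong convexity turns this into a bound on the excess value.

The wave costs curvature `c / h ^ 2 = ρ * h ^ (β - 2)`, at most of order `T ^ (-1/2 + 1/β)`. Hence
`α` is first raised to `a = max α (c₀ * T ^ (-1/2 + 1/β))`, which only shrinks the class
(`targetClass_subset`), and `A` is slightly more than `a`. The choice of `h` in `exists_bandwidth`
makes `d * u ^ 2` of order `min 1 (d / a ^ 2 * T ^ (-(β - 1) / β))`, and `rates_le` compares this
with the stated rates.

The information bound for adaptive queries is `integral_history_le`. It works with the
Donsker–Varadhan inequality and integrates out one noise variable at a time. -/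

/-! ### Taylor estimates for a parabola plus a sine wave on the line. -/

/-- The Taylor polynomial of a function of one real variable. -/
noncomputable def taylorPolyReal (f : ℝ → ℝ) (n : ℕ) (x z : ℝ) : ℝ :=
  ∑ k ∈ Finset.range (n + 1), ((k.factorial : ℝ))⁻¹ * (iteratedDeriv k f x * (z - x) ^ k)

lemma taylorPolyReal_succ (f : ℝ → ℝ) (n : ℕ) (x z : ℝ) :
    taylorPolyReal f (n + 1) x z = taylorPolyReal f n x z +
      (((n + 1).factorial : ℝ))⁻¹ * (iteratedDeriv (n + 1) f x * (z - x) ^ (n + 1)) :=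
  Finset.sum_range_succ _ _

lemma taylorPolyReal_one (f : ℝ → ℝ) (x z : ℝ) :
    taylorPolyReal f 1 x z = f x + deriv f x * (z - x) := by
  simp [taylorPolyReal, Finset.sum_range_succ]

lemma taylorPolyReal_add {f g : ℝ → ℝ} {n : ℕ} (hf : ContDiff ℝ n f) (hg : ContDiff ℝ n g)
    (x z : ℝ) :
    taylorPolyReal (fun s => f s + g s) n x z = taylorPolyReal f n x z + taylorPolyReal g n x z := by
  unfold taylorPolyReal
  rw [← Finset.sum_add_distrib]
  refine Finset.sum_congr rfl fun k hk => ?_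
  have hk' : (k : WithTop ℕ∞) ≤ n := by
    exact_mod_cast Nat.lt_succ_iff.mp (Finset.mem_range.mp hk)
  have := iteratedDeriv_add (n := k) (x := x) (hf.of_le hk').contDiffAt (hg.of_le hk').contDiffAt
  rw [show (fun s => f s + g s) = f + g from rfl, this]
  ring

lemma abs_sub_taylorPolyReal_le {f : ℝ → ℝ} {n : ℕ} {M : ℝ} (hf : ContDiff ℝ (n + 1) f)
    (hM : ∀ y, |iteratedDeriv (n + 1) f y| ≤ M) (x z : ℝ) :
    |f z - taylorPolyReal f n x z| ≤ M * |z - x| ^ (n + 1) / (n + 1).factorial := by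
  rcases eq_or_ne x z with rfl | hxz
  · have : taylorPolyReal f n x x = f x := by
      unfold taylorPolyReal
      rw [Finset.sum_range_succ']
      simp
    simp [this]
  obtain ⟨y, -, hy⟩ := taylor_mean_remainder_lagrange_iteratedDeriv hxz hf.contDiffOn
  have hT : taylorWithinEval f n (Set.uIcc x z) x z = taylorPolyReal f n x z := by
    rw [taylor_within_apply]
    refine Finset.sum_congr rfl fun k hk => ?_
    have hk' : (k : WithTop ℕ∞) ≤ n + 1 := by
      exact_mod_cast (Finset.mem_range.mp hk).le
    rw [iteratedDerivWithin_eq_iteratedDeriv (s := Set.uIcc x z)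
      (uniqueDiffOn_Icc (by simpa using hxz.symm)) (hf.of_le hk').contDiffAt
      Set.left_mem_uIcc, smul_eq_mul]
    ring
  rw [hT] at hy
  rw [hy, abs_div, abs_mul, abs_pow, Nat.abs_cast]
  gcongr
  exact hM y

/-- A scaled sine wave. -/
noncomputable def wave (c h s : ℝ) : ℝ := c * Real.sin (s / h)

lemma contDiff_wave (c h : ℝ) {n : WithTop ℕ∞} : ContDiff ℝ n (wave c h) := by
  unfold wave
  fun_prop

lemma abs_iteratedDeriv_wave_le {c h : ℝ} (hh : 0 < h) (k : ℕ) (s : ℝ) :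
    |iteratedDeriv k (wave c h) s| ≤ |c| * h⁻¹ ^ k := by
  have h1 : wave c h = fun s => c * (fun s => Real.sin (h⁻¹ * s)) s := by
    funext s; simp [wave, div_eq_inv_mul]
  rw [h1, iteratedDeriv_const_mul_field,
    iteratedDeriv_comp_const_mul Real.contDiff_sin, abs_mul, abs_mul, abs_pow,
    abs_of_pos (inv_pos.mpr hh)]
  have := Real.abs_iteratedDeriv_sin_le_one k (h⁻¹ * s)
  gcongr
  exact mul_le_of_le_one_right (by positivity) this

lemma abs_wave_sub_taylorPolyReal_le_pow {c h : ℝ} (hh : 0 < h) (n : ℕ) (x z : ℝ) :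
    |wave c h z - taylorPolyReal (wave c h) n x z| ≤
      |c| * (|z - x| / h) ^ (n + 1) / (n + 1).factorial := by
  refine (abs_sub_taylorPolyReal_le (contDiff_wave c h)
    (abs_iteratedDeriv_wave_le hh _) x z).trans_eq ?_
  rw [div_pow, inv_pow]
  ring

/-- With `t = |z - x| / h`, the remainder of order `n + 1` suffices for `t ≤ 1`, where `t ^ (n + 1)
≤ t ^ β`. For `t ≥ 1` the expansion is cut one order earlier: the remainder and the last Taylor term
are each at most `|c| * t ^ n ≤ |c| * t ^ β`, whence the factor 2. -/
lemma abs_wave_sub_taylorPolyReal_le_rpow {c h β : ℝ} (hh : 0 < h) {n : ℕ} (hn : 1 ≤ n)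
    (hn1 : (n : ℝ) < β) (hn2 : β ≤ n + 1) (x z : ℝ) :
    |wave c h z - taylorPolyReal (wave c h) n x z| ≤ 2 * |c| * (|z - x| / h) ^ β := by
  set t := |z - x| / h with ht
  have ht0 : 0 ≤ t := by positivity
  have hfac (m : ℕ) : (1 : ℝ) ≤ m.factorial := by exact_mod_cast m.factorial_pos
  rcases le_total t 1 with h1 | h1
  · have h2 : t ^ (n + 1) ≤ t ^ β := by
      have := Real.rpow_le_rpow_of_exponent_ge_of_imp ht0 h1 hn2 (fun _ h => by
        have : (1 : ℝ) ≤ n := by exact_mod_cast hn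
        linarith)
      rwa [← Nat.cast_add_one, Real.rpow_natCast] at this
    calc _ ≤ |c| * t ^ (n + 1) / (n + 1).factorial := abs_wave_sub_taylorPolyReal_le_pow hh n x z
      _ ≤ |c| * t ^ (n + 1) := div_le_self (by positivity) (hfac _)
      _ ≤ |c| * t ^ β := by gcongr
      _ ≤ 2 * |c| * t ^ β := by nlinarith [mul_nonneg (abs_nonneg c) (Real.rpow_nonneg ht0 β)]
  · obtain ⟨m, rfl⟩ : ∃ m, n = m + 1 := ⟨n - 1, by omega⟩
    have h2 : t ^ (m + 1) ≤ t ^ β := by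
      rw [← Real.rpow_natCast]
      exact Real.rpow_le_rpow_of_exponent_le h1 hn1.le
    have h3 := abs_wave_sub_taylorPolyReal_le_pow (c := c) hh m x z
    have h4 : |(((m + 1).factorial : ℝ))⁻¹ *
        (iteratedDeriv (m + 1) (wave c h) x * (z - x) ^ (m + 1))| ≤ |c| * t ^ (m + 1) := by
      rw [abs_mul, abs_mul, abs_pow, abs_of_nonneg (by positivity)]
      have := abs_iteratedDeriv_wave_le (c := c) hh (m + 1) x
      calc _ ≤ 1 * (|c| * h⁻¹ ^ (m + 1) * |z - x| ^ (m + 1)) := by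
            gcongr
            exact inv_le_one_of_one_le₀ (hfac _)
        _ = _ := by rw [ht, div_pow, inv_pow]; ring
    have h5 : |c| * t ^ (m + 1) / (m + 1).factorial ≤ |c| * t ^ (m + 1) :=
      div_le_self (by positivity) (hfac _)
    rw [taylorPolyReal_succ, ← sub_sub]
    calc _ ≤ _ := abs_sub _ _
      _ ≤ |c| * t ^ (m + 1) + |c| * t ^ (m + 1) := add_le_add (h3.trans h5) h4
      _ = 2 * |c| * t ^ (m + 1) := by ring
      _ ≤ _ := by gcongr

lemma taylorPolyReal_sq_one (a x z : ℝ) :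
    a * z ^ 2 - taylorPolyReal (fun s => a * s ^ 2) 1 x z = a * (z - x) ^ 2 := by
  rw [taylorPolyReal_one]
  simp
  ring

/-- For `β > 2` the curvature therefore costs nothing in the Hölder condition. Only `β = 2`, where
the expansion stops at order 1, ties it to `L`. -/
lemma taylorPolyReal_sq_of_two_le (a x z : ℝ) {n : ℕ} (hn : 2 ≤ n) :
    taylorPolyReal (fun s => a * s ^ 2) n x z = a * z ^ 2 := by
  have h0 : ∀ y, |iteratedDeriv (n + 1) (fun s : ℝ => a * s ^ 2) y| ≤ 0 := by
    intro y
    rw [iteratedDeriv_const_mul_field, iteratedDeriv_pow,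
      Nat.descFactorial_of_lt (by omega : 2 < n + 1)]
    simp
  have := abs_sub_taylorPolyReal_le (f := fun s : ℝ => a * s ^ 2) (n := n) (by fun_prop) h0 x z
  simp only [zero_mul, zero_div, abs_nonpos_iff, sub_eq_zero] at this
  exact this.symm

/-- A quadratic function perturbed by a sine wave. -/
noncomputable def coordFun (A c h s : ℝ) : ℝ := A / 2 * s ^ 2 + wave c h s

lemma contDiff_coordFun (A c h : ℝ) {n : WithTop ℕ∞} : ContDiff ℝ n (coordFun A c h) := by
  unfold coordFun wave
  fun_prop

lemma hasDerivAt_coordFun (A c h s : ℝ) :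
    HasDerivAt (coordFun A c h) (A * s + c / h * Real.cos (s / h)) s := by
  have h1 : HasDerivAt (fun s : ℝ => A / 2 * s ^ 2) (A / 2 * (2 * s)) s := by
    simpa using (hasDerivAt_pow 2 s).const_mul (A / 2)
  have h2 : HasDerivAt (wave c h) (c * (Real.cos (s / h) * (1 / h))) s :=
    ((hasDerivAt_id s).div_const h).sin.const_mul c
  exact (h1.add h2).congr_deriv (by ring)

lemma coordFun_sub_taylorPolyReal (A c h : ℝ) (n : ℕ) (x z : ℝ) :
    coordFun A c h z - taylorPolyReal (coordFun A c h) n x z =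
      (A / 2 * z ^ 2 - taylorPolyReal (fun s => A / 2 * s ^ 2) n x z) +
      (wave c h z - taylorPolyReal (wave c h) n x z) := by
  have := taylorPolyReal_add (f := fun s => A / 2 * s ^ 2) (g := wave c h) (n := n)
    (by fun_prop) (contDiff_wave c h) x z
  rw [show coordFun A c h = fun s => A / 2 * s ^ 2 + wave c h s from rfl, this]
  ring

/-- The second derivative of the wave is at most `|c| / h ^ 2`, which the excess curvature `A - α`
absorbs. -/
lemma coordFun_strongly_convex {A c h α : ℝ} (hh : 0 < h) (hc : |c| / h ^ 2 ≤ A - α) (x z : ℝ) :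
    coordFun A c h x + (A * x + c / h * Real.cos (x / h)) * (z - x) + α / 2 * (z - x) ^ 2 ≤
      coordFun A c h z := by
  have h1 := coordFun_sub_taylorPolyReal A c h 1 x z
  rw [taylorPolyReal_sq_one, taylorPolyReal_one, (hasDerivAt_coordFun A c h x).deriv] at h1
  have h2 := (abs_le.mp (abs_wave_sub_taylorPolyReal_le_pow (c := c) hh 1 x z)).1
  have h3 : |c| * (|z - x| / h) ^ (1 + 1) / ((1 + 1).factorial : ℝ) =
      |c| / h ^ 2 * (z - x) ^ 2 / 2 := by
    rw [div_pow, sq_abs, show (1 + 1 : ℕ).factorial = 2 from rfl]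
    push_cast
    ring
  rw [h3] at h2
  nlinarith [mul_le_mul_of_nonneg_right hc (sq_nonneg (z - x))]

lemma abs_coordFun_sub_taylorPolyReal_le {A c h β K : ℝ} (hA : 0 ≤ A) (hh : 0 < h) {n : ℕ}
    (hn : 1 ≤ n) (hn1 : (n : ℝ) < β) (hn2 : β ≤ n + 1)
    (h1 : n = 1 → β = 2 ∧ A / 2 + 2 * |c| / h ^ β ≤ K) (h2 : 2 * |c| / h ^ β ≤ K) (x z : ℝ) :
    |coordFun A c h z - taylorPolyReal (coordFun A c h) n x z| ≤ K * |z - x| ^ β := by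
  have hw := abs_wave_sub_taylorPolyReal_le_rpow (c := c) hh hn hn1 hn2 x z
  have hw' : 2 * |c| * (|z - x| / h) ^ β = 2 * |c| / h ^ β * |z - x| ^ β := by
    rw [Real.div_rpow (abs_nonneg _) hh.le]
    ring
  rw [hw'] at hw
  rw [coordFun_sub_taylorPolyReal]
  rcases Nat.lt_or_ge 1 n with hn' | hn'
  · rw [taylorPolyReal_sq_of_two_le _ _ _ hn', sub_self, zero_add]
    exact hw.trans (by gcongr)
  · obtain rfl : n = 1 := by omega
    obtain ⟨rfl, hK⟩ := h1 rfl
    rw [taylorPolyReal_sq_one]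
    have h3 : |A / 2 * (z - x) ^ 2| = A / 2 * |z - x| ^ (2 : ℝ) := by
      rw [abs_of_nonneg (by positivity)]
      simp
    calc _ ≤ _ := abs_add_le _ _
      _ ≤ A / 2 * |z - x| ^ (2 : ℝ) + 2 * |c| / h ^ (2 : ℝ) * |z - x| ^ (2 : ℝ) := by
        rw [h3]; gcongr
      _ = (A / 2 + 2 * |c| / h ^ (2 : ℝ)) * |z - x| ^ (2 : ℝ) := by ring
      _ ≤ _ := by gcongr

/-- A critical point of `coordFun A c h`, for `c > 0`, of the order `c / (h A)`. -/
lemma exists_critical_point {A c h : ℝ} (hA : 0 < A) (hc : 0 < c) (hh : 0 < h)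
    (hcA : c / h ^ 2 ≤ A) :
    ∃ u, 0 ≤ u ∧ u ≤ c / (h * A) ∧ c / (2 * (h * A)) ≤ u ∧ A * u = c / h * Real.cos (u / h) := by
  have hb : 0 ≤ c / (h * A) := by positivity
  have hcont : ContinuousOn (fun u => A * u - c / h * Real.cos (u / h))
      (Set.Icc 0 (c / (h * A))) := by fun_prop
  obtain ⟨u, ⟨hu0, hu1⟩, hu⟩ := intermediate_value_Icc hb hcont
    (show (0 : ℝ) ∈ _ from ⟨by simp; positivity, by
      have : A * (c / (h * A)) = c / h := by field_simp
      simp only [this]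
      nlinarith [Real.cos_le_one (c / (h * A) / h), (by positivity : 0 < c / h)]⟩)
  have hu' : A * u = c / h * Real.cos (u / h) := sub_eq_zero.mp hu
  refine ⟨u, hu0, hu1, ?_, hu'⟩
  -- The upper bound on `u` keeps `u / h` in a range where the cosine is at least `1 / 2`; the
  -- critical point equation then gives the lower bound.
  have huh : u / h ≤ 1 := by
    calc u / h ≤ c / (h * A) / h := by gcongr
      _ = c / h ^ 2 / A := by field_simp
      _ ≤ 1 := (div_le_one hA).mpr hcA
  have huh0 : 0 ≤ u / h := by positivity
  have hcos : 1 / 2 ≤ Real.cos (u / h) := by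
    have := Real.one_sub_sq_div_two_le_cos (x := u / h)
    nlinarith
  have : c / h * (1 / 2) ≤ A * u := by rw [hu']; gcongr
  calc c / (2 * (h * A)) = c / h * (1 / 2) / A := by field_simp
    _ ≤ A * u / A := by gcongr
    _ = u := by field_simp

/-! ### Sums of functions of single coordinates. -/

section Separable

variable {d : ℕ}

/-- The sum of functions of the individual coordinates. -/
noncomputable def separable (φ : Fin d → ℝ → ℝ) (x : E d) : ℝ := ∑ i, φ i (x i)

lemma contDiff_separable {φ : Fin d → ℝ → ℝ} {n : WithTop ℕ∞} (hφ : ∀ i, ContDiff ℝ n (φ i)) :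
    ContDiff ℝ n (separable φ) := by
  unfold separable
  refine ContDiff.sum fun i _ => (hφ i).comp ?_
  exact (EuclideanSpace.proj (𝕜 := ℝ) i).contDiff

lemma iteratedFDeriv_separable {φ : Fin d → ℝ → ℝ} {k : ℕ} (hφ : ∀ i, ContDiff ℝ k (φ i))
    (x v : E d) :
    iteratedFDeriv ℝ k (separable φ) x (fun _ => v) =
      ∑ i, iteratedDeriv k (φ i) (x i) * v i ^ k := by
  have h1 : separable φ = fun x => ∑ i, (φ i ∘ EuclideanSpace.proj (𝕜 := ℝ) i) x := rfl
  have h2 (i : Fin d) : ContDiff ℝ k (φ i ∘ EuclideanSpace.proj (𝕜 := ℝ) i) :=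
    (hφ i).comp (EuclideanSpace.proj (𝕜 := ℝ) i).contDiff
  rw [h1, iteratedFDeriv_fun_sum_apply (fun i _ => (h2 i).contDiffAt),
    sum_apply]
  refine Finset.sum_congr rfl fun i _ => ?_
  rw [ContinuousLinearMap.iteratedFDeriv_comp_right _ (hφ i) _ le_rfl,
    ContinuousMultilinearMap.compContinuousLinearMap_apply,
    iteratedFDeriv_apply_eq_iteratedDeriv_mul_prod]
  simp [mul_comm]

lemma taylorPoly_separable {φ : Fin d → ℝ → ℝ} {n : ℕ} (hφ : ∀ i, ContDiff ℝ n (φ i))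
    (x z : E d) :
    taylorPoly (separable φ) n x z = ∑ i, taylorPolyReal (φ i) n (x i) (z i) := by
  unfold taylorPoly taylorPolyReal
  rw [Finset.sum_comm]
  refine Finset.sum_congr rfl fun k hk => ?_
  have hk' : (k : WithTop ℕ∞) ≤ n := by
    exact_mod_cast Nat.lt_succ_iff.mp (Finset.mem_range.mp hk)
  rw [iteratedFDeriv_separable fun i => (hφ i).of_le hk', Finset.mul_sum]
  simp

lemma gradient_separable {φ φ' : Fin d → ℝ → ℝ} (hφ : ∀ i s, HasDerivAt (φ i) (φ' i s) s)
    (x : E d) :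
    gradient (separable φ) x = WithLp.toLp 2 fun i => φ' i (x i) := by
  refine HasGradientAt.gradient ?_
  rw [hasGradientAt_iff_hasFDerivAt]
  have h1 (i : Fin d) : HasFDerivAt (fun x : E d => φ i (x i))
      (φ' i (x i) • (EuclideanSpace.proj (𝕜 := ℝ) i : E d →L[ℝ] ℝ)) x :=
    (hφ i (x i)).comp_hasFDerivAt x (EuclideanSpace.proj (𝕜 := ℝ) i : E d →L[ℝ] ℝ).hasFDerivAt
  have h2 := HasFDerivAt.fun_sum (u := Finset.univ) fun i _ => h1 i
  have h3 : InnerProductSpace.toDual ℝ (E d) (WithLp.toLp 2 fun i => φ' i (x i)) =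
      ∑ i, φ' i (x i) • (EuclideanSpace.proj (𝕜 := ℝ) i : E d →L[ℝ] ℝ) := by
    ext v
    simp [InnerProductSpace.toDual_apply_apply, PiLp.inner_apply, mul_comm, sum_apply]
  rw [h3]
  exact h2

/-- This keeps the Hölder constant of a separable function free of `d`, and it is where `β ≥ 2`
matters. -/
lemma sum_abs_rpow_le {β : ℝ} (hβ : 2 ≤ β) (v : E d) : ∑ i, |v i| ^ β ≤ ‖v‖ ^ β := by
  have hsplit {a : ℝ} (ha : 0 ≤ a) : a ^ β = a ^ 2 * a ^ (β - 2) := by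
    rw [← Real.rpow_natCast, ← Real.rpow_add_of_nonneg ha (by norm_num) (by linarith)]
    norm_num
  calc ∑ i, |v i| ^ β = ∑ i, |v i| ^ 2 * |v i| ^ (β - 2) :=
        Finset.sum_congr rfl fun i _ => hsplit (abs_nonneg _)
    _ ≤ ∑ i, |v i| ^ 2 * ‖v‖ ^ (β - 2) := by
        refine Finset.sum_le_sum fun i _ => ?_
        refine mul_le_mul_of_nonneg_left ?_ (sq_nonneg _)
        exact Real.rpow_le_rpow (abs_nonneg _) (PiLp.norm_apply_le v i) (by linarith)
    _ = ‖v‖ ^ β := by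
        rw [← Finset.sum_mul, hsplit (norm_nonneg v), EuclideanSpace.norm_sq_eq]
        simp

end Separable

/-! ### Relative entropy, independence and a two-point test. -/

section Information

variable {α : Type*} [MeasurableSpace α]

lemma integrable_of_abs_le {μ : Measure α} [IsFiniteMeasure μ] {g : α → ℝ} (hg : Measurable g)
    {B : ℝ} (hB : ∀ x, |g x| ≤ B) : Integrable g μ :=
  Integrable.of_bound hg.aestronglyMeasurable B (Filter.Eventually.of_forall hB)

lemma integrable_exp_of_abs_le {μ : Measure α} [IsFiniteMeasure μ] {g : α → ℝ}
    (hg : Measurable g) {B : ℝ} (hB : ∀ x, |g x| ≤ B) : Integrable (fun x => Real.exp (g x)) μ :=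
  integrable_of_abs_le (B := Real.exp B) hg.exp fun x => by
    rw [Real.abs_exp]
    exact Real.exp_le_exp.mpr ((le_abs_self _).trans (hB x))

/-- The easy half of the Donsker–Varadhan variational formula. -/
lemma integral_le_add_log_integral_exp {μ ν : Measure α} [IsProbabilityMeasure μ]
    [IsProbabilityMeasure ν] {K : ℝ} (hK : 0 ≤ K)
    (h : InformationTheory.klDiv μ ν ≤ ENNReal.ofReal K) {g : α → ℝ} (hg : Measurable g) {B : ℝ}
    (hB : ∀ x, |g x| ≤ B) :
    ∫ x, g x ∂μ ≤ K + Real.log (∫ x, Real.exp (g x) ∂ν) := by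
  have hne : InformationTheory.klDiv μ ν ≠ ∞ := (h.trans_lt ENNReal.ofReal_lt_top).ne
  obtain ⟨hac, hint⟩ := InformationTheory.klDiv_ne_top_iff.mp hne
  have hexp := integrable_exp_of_abs_le (μ := ν) hg hB
  have := isProbabilityMeasure_tilted hexp
  have hac' : μ ≪ ν.tilted g := hac.trans (absolutelyContinuous_tilted hexp)
  have h1 := integral_llr_tilted_right hac (integrable_of_abs_le hg hB) hexp hint
  have h2 := InformationTheory.toReal_klDiv_of_measure_eq hac (by simp)
  have h3 := InformationTheory.toReal_klDiv_of_measure_eq hac' (by simp)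
  have h4 : (InformationTheory.klDiv μ ν).toReal ≤ K := ENNReal.toReal_le_of_le_ofReal hK h
  have h5 : 0 ≤ (InformationTheory.klDiv μ (ν.tilted g)).toReal := ENNReal.toReal_nonneg
  linarith

lemma abs_log_integral_exp_le {ν : Measure α} [IsProbabilityMeasure ν] {g : α → ℝ}
    (hg : Measurable g) {B : ℝ} (hB : ∀ x, |g x| ≤ B) :
    |Real.log (∫ x, Real.exp (g x) ∂ν)| ≤ B := by
  have hexp := integrable_exp_of_abs_le (μ := ν) hg hB
  have hpos : 0 < ∫ x, Real.exp (g x) ∂ν := integral_exp_pos hexp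
  rw [abs_le]
  constructor
  · rw [Real.le_log_iff_exp_le hpos]
    calc Real.exp (-B) = ∫ _, Real.exp (-B) ∂ν := by simp
      _ ≤ _ := integral_mono (integrable_const _) hexp fun x =>
        Real.exp_le_exp.mpr (abs_le.mp (hB x)).1
  · rw [Real.log_le_iff_le_exp hpos]
    calc _ ≤ ∫ _, Real.exp B ∂ν := integral_mono hexp (integrable_const _) fun x =>
          Real.exp_le_exp.mpr (abs_le.mp (hB x)).2
      _ = Real.exp B := by simp

lemma integral_comp_of_indepFun {Ω γ : Type*} [MeasurableSpace Ω] [MeasurableSpace γ]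
    {P : Measure Ω} [IsProbabilityMeasure P] {X : Ω → α} {Y : Ω → γ} (hX : Measurable X)
    (hY : Measurable Y) (hXY : IndepFun X Y P) {k : α × γ → ℝ} (hk : Measurable k) {B : ℝ}
    (hB : ∀ x, |k x| ≤ B) :
    ∫ ω, k (X ω, Y ω) ∂P = ∫ ω, ∫ y, k (X ω, y) ∂(P.map Y) ∂P := by
  have h1 := (indepFun_iff_map_prod_eq_prod_map_map hX.aemeasurable hY.aemeasurable).mp hXY
  have := Measure.isProbabilityMeasure_map (μ := P) hX.aemeasurable
  have := Measure.isProbabilityMeasure_map (μ := P) hY.aemeasurable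
  rw [← integral_map (φ := fun ω => (X ω, Y ω)) (f := k) (hX.prodMk hY).aemeasurable
    hk.aestronglyMeasurable, h1, integral_prod _ (integrable_of_abs_le hk hB)]
  exact integral_map hX.aemeasurable
    (hk.stronglyMeasurable.integral_prod_right' (ν := P.map Y)).aestronglyMeasurable

lemma indepFun_prodMk_left {Ω γ δ : Type*} [MeasurableSpace Ω] [MeasurableSpace γ]
    [MeasurableSpace δ] {P : Measure Ω} [IsProbabilityMeasure P] {X : Ω → α} {Y : Ω → γ}
    {Z : Ω → δ} (hX : Measurable X) (hY : Measurable Y) (hZ : Measurable Z)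
    (h1 : IndepFun X (fun ω => (Y ω, Z ω)) P) (h2 : IndepFun Y Z P) :
    IndepFun (fun ω => (X ω, Y ω)) Z P := by
  have hXY : IndepFun X Y P := h1.comp measurable_id measurable_fst
  rw [indepFun_iff_map_prod_eq_prod_map_map (by fun_prop) (by fun_prop)] at h1 h2 hXY ⊢
  refine MeasurableEquiv.prodAssoc.map_measurableEquiv_injective ?_
  rw [hXY, Measure.prodAssoc_prod, ← h2, ← h1,
    Measure.map_map MeasurableEquiv.prodAssoc.measurable (by fun_prop)]
  rfl

/-- If an event has probability `p` under one law and `q` under another one whose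
Kullback–Leibler divergence from the first is at most `1/2`, then the sum of the errors of the
test that it defines is at least `1/4`. -/
lemma quarter_le_of_log_nine_mul_le {p q : ℝ} (hp : p ≤ 1) (hq : 0 ≤ q)
    (h : Real.log 9 * p ≤ 1 / 2 + Real.log (1 + 8 * q)) : 1 / 4 ≤ 1 - p + q := by
  -- Otherwise `p > 3/4` and `q < 1/4`, so that `(3/2) * log 3 < 1/2 + log 3`, which fails because
  -- `log 3 > 1`.
  by_contra! hlt
  have h9 : Real.log 9 = 2 * Real.log 3 := by
    rw [show (9 : ℝ) = 3 ^ 2 by norm_num, Real.log_pow]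
    norm_num
  have h3 : 1 < Real.log 3 := by
    rw [Real.lt_log_iff_exp_lt (by norm_num)]
    exact Real.exp_one_lt_d9.trans (by norm_num)
  have hle : Real.log (1 + 8 * q) ≤ Real.log 3 :=
    Real.log_le_log (by linarith) (by linarith)
  nlinarith

end Information

/-! ### Histories of a sequential strategy and their information content. -/

section Strategy

variable {d : ℕ}

lemma query_congr (S : Strategy d) (f : E d → ℝ) (z : E d) {e e' : ℕ → ℝ} (t : ℕ)
    (h : ∀ s < t, e s = e' s) : query S f z e t = query S f z e' t := by
  induction t using Nat.strong_induction_on with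
  | _ t ih =>
    rcases t with _ | t
    · simp [query]
    · have h1 (s : Fin (t + 1)) : query S f z e s = query S f z e' s :=
        ih s s.isLt fun r hr => h r (hr.trans s.isLt)
      have h2 (s : Fin (t + 1)) : e s = e' s := h s s.isLt
      rw [query, query]
      simp only [h1, h2]

/-- The query points as functions of the first query point and of the observations. -/
noncomputable def queryOf (S : Strategy d) (x : E d × (ℕ → ℝ)) : ℕ → E d
  | 0 => x.1
  | t + 1 => S.next (t + 1)
      (fun s : Fin (t + 1) => queryOf S x s, fun s : Fin (t + 1) => x.2 s)
termination_by t => t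
decreasing_by all_goals exact s.isLt

/-- The first query point and the first `t` observations (followed by zeros). -/
noncomputable def history (S : Strategy d) (f : E d → ℝ) (z : E d) (e : ℕ → ℝ) (t : ℕ) :
    E d × (ℕ → ℝ) :=
  (z, fun s => if s < t then f (query S f z e s) + e s else 0)

lemma history_congr (S : Strategy d) (f : E d → ℝ) (z : E d) {e e' : ℕ → ℝ} (t : ℕ)
    (h : ∀ s < t, e s = e' s) : history S f z e t = history S f z e' t := by
  unfold history
  congr 1
  funext s
  split_ifs with hs
  · rw [h s hs, query_congr S f z s fun r hr => h r (hr.trans hs)]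
  · rfl

lemma queryOf_history (S : Strategy d) (f : E d → ℝ) (z : E d) (e : ℕ → ℝ) {t n : ℕ}
    (htn : t ≤ n) : queryOf S (history S f z e n) t = query S f z e t := by
  induction t using Nat.strong_induction_on with
  | _ t ih =>
    rcases t with _ | t
    · simp [query, queryOf, history]
    · have h1 (s : Fin (t + 1)) : queryOf S (history S f z e n) s = query S f z e s :=
        ih s s.isLt (s.isLt.le.trans htn)
      have h2 (s : Fin (t + 1)) : (history S f z e n).2 s = f (query S f z e s) + e s :=
        if_pos (s.isLt.trans_le htn)
      rw [query, queryOf]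
      simp only [h1, h2]

/-- Appending an observation, with the noise `u`, to a history of length `t`. -/
noncomputable def appendObs (S : Strategy d) (f : E d → ℝ) (t : ℕ)
    (p : (E d × (ℕ → ℝ)) × ℝ) : E d × (ℕ → ℝ) :=
  (p.1.1, Function.update p.1.2 t (f (queryOf S p.1 t) + p.2))

lemma history_succ (S : Strategy d) (f : E d → ℝ) (z : E d) (e : ℕ → ℝ) (t : ℕ) :
    history S f z e (t + 1) = appendObs S f t (history S f z e t, e t) := by
  unfold appendObs
  rw [queryOf_history S f z e le_rfl]
  unfold history
  congr 1
  funext s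
  rcases lt_trichotomy s t with h | rfl | h
  · simp [h, h.ne, h.trans (Nat.lt_succ_self t)]
  · simp
  · simp [h.ne', h.not_gt, show ¬ s < t + 1 by omega]

lemma measurable_queryOf (S : Strategy d) (t : ℕ) : Measurable fun x => queryOf S x t := by
  induction t using Nat.strong_induction_on with
  | _ t ih =>
    rcases t with _ | t
    · simpa [queryOf] using measurable_fst
    · simp only [queryOf]
      refine (S.measurable_next (t + 1)).comp (Measurable.prodMk ?_ ?_)
      · exact measurable_pi_lambda _ fun s => ih s s.isLt
      · exact measurable_pi_lambda _ fun s => (measurable_pi_apply _).comp measurable_snd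

lemma measurable_appendObs (S : Strategy d) {f : E d → ℝ} (hf : Measurable f) (t : ℕ) :
    Measurable (appendObs S f t) := by
  have h1 : Measurable fun p : (E d × (ℕ → ℝ)) × ℝ => f (queryOf S p.1 t) + p.2 :=
    (hf.comp ((measurable_queryOf S t).comp measurable_fst)).add measurable_snd
  refine measurable_fst.fst.prodMk (measurable_pi_lambda _ fun s => ?_)
  by_cases hs : s = t
  · subst hs
    simpa using h1
  · simp only [Function.update_of_ne hs]
    exact (measurable_pi_apply s).comp measurable_fst.snd

lemma measurable_history (S : Strategy d) {f : E d → ℝ} (hf : Measurable f) (t : ℕ) :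
    Measurable fun p : E d × (ℕ → ℝ) => history S f p.1 p.2 t := by
  induction t with
  | zero => simpa [history] using measurable_fst.prodMk measurable_const
  | succ t ih =>
    simp only [history_succ]
    exact (measurable_appendObs S hf t).comp
      (ih.prodMk ((measurable_pi_apply t).comp measurable_snd))

variable {Ω : Type*} [MeasurableSpace Ω] {P : Measure Ω} [IsProbabilityMeasure P]
  {z₁ : Ω → E d} {ξ : ℕ → Ω → ℝ} {ν : Measure ℝ} [IsProbabilityMeasure ν]

lemma measurable_history_comp (S : Strategy d) {f : E d → ℝ} (hf : Measurable f)
    (hz : Measurable z₁) (hξ : ∀ t, Measurable (ξ t)) (t : ℕ) :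
    Measurable fun ω => history S f (z₁ ω) (fun s => ξ s ω) t :=
  (measurable_history S hf t).comp (hz.prodMk (measurable_pi_lambda _ hξ))

/-- Comparison of the laws of the history under two objectives: the Kullback–Leibler divergence
grows by at most `K` with every observation. -/
lemma integral_history_le (S : Strategy d) {f f' : E d → ℝ} (hf : Measurable f)
    (hf' : Measurable f') (hz : Measurable z₁) (hξ : ∀ t, Measurable (ξ t)) {n : ℕ}
    (hlaw : ∀ t < n, P.map (ξ t) = ν)
    (hind : ∀ t < n, IndepFun (fun ω => (z₁ ω, fun s => if s < t then ξ s ω else 0)) (ξ t) P)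
    {K : ℝ} (hK : 0 ≤ K)
    (hKL : ∀ x, InformationTheory.klDiv ν (ν.map fun u => u - (f x - f' x)) ≤ ENNReal.ofReal K)
    {t : ℕ} (ht : t ≤ n) {g : E d × (ℕ → ℝ) → ℝ} (hg : Measurable g) {B : ℝ}
    (hB : ∀ x, |g x| ≤ B) :
    ∫ ω, g (history S f (z₁ ω) (fun s => ξ s ω) t) ∂P ≤
      t * K + Real.log (∫ ω, Real.exp (g (history S f' (z₁ ω) (fun s => ξ s ω) t)) ∂P) := by
  -- The test function must vary: integrating out the last noise replaces `g` by `log I`, a bounded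
  -- measurable function of the shorter history.
  induction t generalizing g with
  | zero =>
    have := integral_le_add_log_integral_exp (μ := P) (ν := P) le_rfl
      (by rw [InformationTheory.klDiv_self]; simp)
      (hg.comp (measurable_history_comp S hf hz hξ 0)) fun ω => hB _
    simpa [history] using this
  | succ t ih =>
    have htn : t < n := ht
    have hindep {φ : E d → ℝ} (hφ : Measurable φ) :
        IndepFun (fun ω => history S φ (z₁ ω) (fun s => ξ s ω) t) (ξ t) P := by
      have h := (hind t htn).comp (measurable_history S hφ t) measurable_id
      have heq : (fun ω => history S φ (z₁ ω) (fun s => ξ s ω) t) =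
          (fun p : E d × (ℕ → ℝ) => history S φ p.1 p.2 t) ∘
            fun ω => (z₁ ω, fun s => if s < t then ξ s ω else 0) := by
        funext ω
        exact history_congr S φ _ t fun s hs => (if_pos hs).symm
      rw [heq]
      exact h
    have hgm {φ : E d → ℝ} (hφ : Measurable φ) : Measurable fun p => g (appendObs S φ t p) :=
      hg.comp (measurable_appendObs S hφ t)
    have hexpB (x : E d × (ℕ → ℝ)) : |Real.exp (g x)| ≤ Real.exp B := by
      rw [Real.abs_exp]
      exact Real.exp_le_exp.mpr ((le_abs_self _).trans (hB x))
    set I : E d × (ℕ → ℝ) → ℝ :=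
      fun x => ∫ u, Real.exp (g (appendObs S f' t (x, u))) ∂ν with hI
    have hIm : Measurable I :=
      ((hgm hf').exp.stronglyMeasurable.integral_prod_right' (ν := ν)).measurable
    have hIpos (x) : 0 < I x := integral_exp_pos
      (integrable_exp_of_abs_le ((hgm hf').comp measurable_prodMk_left) fun _ => hB _)
    have hIB (x) : |Real.log (I x)| ≤ B :=
      abs_log_integral_exp_le ((hgm hf').comp measurable_prodMk_left) fun _ => hB _
    have hstep (x : E d × (ℕ → ℝ)) :
        ∫ u, g (appendObs S f t (x, u)) ∂ν ≤ K + Real.log (I x) := by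
      have hsub : Measurable fun u : ℝ => u - (f (queryOf S x t) - f' (queryOf S x t)) := by
        fun_prop
      have := Measure.isProbabilityMeasure_map (μ := ν) hsub.aemeasurable
      have hm : Measurable fun u => g (appendObs S f t (x, u)) :=
        (hgm hf).comp measurable_prodMk_left
      have h1 := integral_le_add_log_integral_exp hK (hKL (queryOf S x t)) hm fun _ => hB _
      rw [integral_map hsub.aemeasurable hm.exp.aestronglyMeasurable] at h1
      -- Given the past, both objectives are queried at the same point, and shifting the noise by
      -- the difference of their values there turns one observation into the other.
      have hpt (u : ℝ) : appendObs S f t (x, u - (f (queryOf S x t) - f' (queryOf S x t))) =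
          appendObs S f' t (x, u) := by
        simp only [appendObs]
        congr 2
        ring
      simpa only [hpt] using h1
    simp only [history_succ]
    rw [integral_comp_of_indepFun (measurable_history_comp S hf hz hξ t) (hξ t) (hindep hf)
        (hgm hf) (fun _ => hB _),
      integral_comp_of_indepFun (k := fun p => Real.exp (g (appendObs S f' t p)))
        (measurable_history_comp S hf' hz hξ t) (hξ t) (hindep hf')
        (hgm hf').exp (fun _ => hexpB _), hlaw t htn]
    have hH := measurable_history_comp S hf hz hξ t
    calc _ ≤ ∫ ω, (K + Real.log (I (history S f (z₁ ω) (fun s => ξ s ω) t))) ∂P := by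
          refine integral_mono ?_ ?_ fun ω => hstep _
          · refine integrable_of_abs_le (B := B) ?_ fun ω => ?_
            · exact ((hgm hf).stronglyMeasurable.integral_prod_right' (ν := ν)).measurable.comp hH
            · have := norm_integral_le_of_norm_le_const (μ := ν) (C := B)
                (f := fun u => g (appendObs S f t (history S f (z₁ ω) (fun s => ξ s ω) t, u)))
                (Filter.Eventually.of_forall fun u => hB _)
              simpa using this
          · exact (integrable_const _).add
              (integrable_of_abs_le (hIm.log.comp hH) fun _ => hIB _)
      _ = K + ∫ ω, Real.log (I (history S f (z₁ ω) (fun s => ξ s ω) t)) ∂P := by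
          rw [integral_add (g := fun ω => Real.log (I (history S f (z₁ ω) (fun s => ξ s ω) t)))
            (integrable_const _) (integrable_of_abs_le (hIm.log.comp hH) fun _ => hIB _)]
          simp
      _ ≤ K + (t * K + Real.log (∫ ω, Real.exp
            (Real.log (I (history S f' (z₁ ω) (fun s => ξ s ω) t))) ∂P)) := by
          gcongr
          exact ih htn.le hIm.log hIB
      _ = _ := by
          simp only [Real.exp_log (hIpos _)]
          rw [hI]
          push_cast
          ring

lemma measurable_query_comp (S : Strategy d) {f : E d → ℝ} (hf : Measurable f)
    (hz : Measurable z₁) (hξ : ∀ t, Measurable (ξ t)) (t : ℕ) :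
    Measurable fun ω => query S f (z₁ ω) (fun s => ξ s ω) t := by
  simp only [← queryOf_history S f _ _ le_rfl]
  exact (measurable_queryOf S t).comp (measurable_history_comp S hf hz hξ t)

lemma indepFun_prefix {T : ℕ} (hz : Measurable z₁) (hξ : ∀ t < T, Measurable (ξ t))
    (hi : iIndepFun (fun t : Fin T => ξ t) P)
    (hzi : IndepFun z₁ (fun (ω : Ω) (t : Fin T) => ξ t ω) P) {t : ℕ} (ht : t < T) :
    IndepFun (fun ω => (z₁ ω, fun s => if s < t then ξ s ω else 0)) (ξ t) P := by
  have htrunc : Measurable fun (y : Fin T → ℝ) (s : ℕ) =>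
      if hs : s < t then y ⟨s, hs.trans ht⟩ else 0 := by
    refine measurable_pi_lambda _ fun s => ?_
    split_ifs
    · exact measurable_pi_apply _
    · exact measurable_const
  have hYm : Measurable fun (ω : Ω) (s : ℕ) => if s < t then ξ s ω else 0 := by
    refine measurable_pi_lambda _ fun s => ?_
    split_ifs with hs
    · exact hξ s (hs.trans ht)
    · exact measurable_const
  refine indepFun_prodMk_left hz hYm (hξ t ht) ?_ ?_
  · have := hzi.comp measurable_id (htrunc.prodMk (measurable_pi_apply (⟨t, ht⟩ : Fin T)))
    exact this
  · have hdis : Disjoint (Finset.univ.filter fun s : Fin T => (s : ℕ) < t) {⟨t, ht⟩} := by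
      simp
    have h := hi.indepFun_finset _ _ hdis fun s => hξ s s.isLt
    have hext : Measurable
        fun (y : (Finset.univ.filter fun s : Fin T => (s : ℕ) < t) → ℝ) (s : ℕ) =>
          if hs : s < t then y ⟨⟨s, hs.trans ht⟩, by simpa using hs⟩ else 0 := by
      refine measurable_pi_lambda _ fun s => ?_
      split_ifs
      · exact measurable_pi_apply _
      · exact measurable_const
    have := h.comp hext (measurable_pi_apply
      (⟨⟨t, ht⟩, by simp⟩ : ({⟨t, ht⟩} : Finset (Fin T))))
    exact this

/-- The test function is `log 9` on the event that the query lies in `A`. Its exponential has mean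
`1 + 8 * q`, which is the form that `quarter_le_of_log_nine_mul_le` takes. -/
lemma quarter_le_error_sum (S : Strategy d) {f f' : E d → ℝ} (hf : Measurable f)
    (hf' : Measurable f') (hz : Measurable z₁) (hξ : ∀ t, Measurable (ξ t)) {n : ℕ}
    (hlaw : ∀ t < n, P.map (ξ t) = ν)
    (hind : ∀ t < n, IndepFun (fun ω => (z₁ ω, fun s => if s < t then ξ s ω else 0)) (ξ t) P)
    {K : ℝ} (hK : 0 ≤ K) (hnK : n * K ≤ 1 / 2)
    (hKL : ∀ x, InformationTheory.klDiv ν (ν.map fun u => u - (f x - f' x)) ≤ ENNReal.ofReal K)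
    {A : Set (E d)} (hA : MeasurableSet A) :
    1 / 4 ≤ P.real {ω | query S f (z₁ ω) (fun s => ξ s ω) n ∉ A} +
      P.real {ω | query S f' (z₁ ω) (fun s => ξ s ω) n ∈ A} := by
  have hB : MeasurableSet {x : E d × (ℕ → ℝ) | queryOf S x n ∈ A} := measurable_queryOf S n hA
  have hset (φ : E d → ℝ) : {ω | query S φ (z₁ ω) (fun s => ξ s ω) n ∈ A} =
      (fun ω => history S φ (z₁ ω) (fun s => ξ s ω) n) ⁻¹' {x | queryOf S x n ∈ A} := by
    ext ω
    simp [queryOf_history]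
  have hmeas {φ : E d → ℝ} (hφ : Measurable φ) :
      MeasurableSet {ω | query S φ (z₁ ω) (fun s => ξ s ω) n ∈ A} := by
    rw [hset]
    exact measurable_history_comp S hφ hz hξ n hB
  set g : E d × (ℕ → ℝ) → ℝ :=
    {x : E d × (ℕ → ℝ) | queryOf S x n ∈ A}.indicator fun _ => Real.log 9 with hg
  have h9 : 0 ≤ Real.log 9 := Real.log_nonneg (by norm_num)
  have hgB (x) : |g x| ≤ Real.log 9 := by
    rw [hg]
    by_cases hx : x ∈ {x : E d × (ℕ → ℝ) | queryOf S x n ∈ A}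
    · rw [Set.indicator_of_mem hx, abs_of_nonneg h9]
    · rw [Set.indicator_of_notMem hx, abs_zero]; exact h9
  have key := integral_history_le S hf hf' hz hξ hlaw hind hK hKL le_rfl
    (measurable_const.indicator hB) hgB
  have h1 : ∫ ω, g (history S f (z₁ ω) (fun s => ξ s ω) n) ∂P =
      Real.log 9 * P.real {ω | query S f (z₁ ω) (fun s => ξ s ω) n ∈ A} := by
    have : (fun ω => g (history S f (z₁ ω) (fun s => ξ s ω) n)) =
        {ω | query S f (z₁ ω) (fun s => ξ s ω) n ∈ A}.indicator fun _ => Real.log 9 := by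
      rw [hset]; rfl
    rw [this, integral_indicator_const _ (hmeas hf), smul_eq_mul, mul_comm]
  have h2 : ∫ ω, Real.exp (g (history S f' (z₁ ω) (fun s => ξ s ω) n)) ∂P =
      1 + 8 * P.real {ω | query S f' (z₁ ω) (fun s => ξ s ω) n ∈ A} := by
    have : (fun ω => Real.exp (g (history S f' (z₁ ω) (fun s => ξ s ω) n))) = fun ω =>
        1 + {ω | query S f' (z₁ ω) (fun s => ξ s ω) n ∈ A}.indicator (fun _ => (8 : ℝ)) ω := by
      funext ω
      rw [hset]
      simp only [hg, Set.indicator]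
      split_ifs with h3 h4 h4
      · rw [Real.exp_log (by norm_num)]; norm_num
      · exact absurd h3 h4
      · exact absurd h4 h3
      · simp
    rw [this, integral_add (integrable_const _)
      ((integrable_const _).indicator (hmeas hf')), integral_indicator_const _ (hmeas hf')]
    simp [mul_comm]
  rw [h1, h2] at key
  have h3 := quarter_le_of_log_nine_mul_le measureReal_le_one measureReal_nonneg
    (key.trans (by gcongr))
  have h4 := probReal_compl_eq_one_sub (μ := P) (hmeas hf)
  rw [show {ω | query S f (z₁ ω) (fun s => ξ s ω) n ∉ A} =
    {ω | query S f (z₁ ω) (fun s => ξ s ω) n ∈ A}ᶜ from rfl, h4]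
  exact h3

end Strategy

/-! ### Critical points of strongly convex functions. -/

section StronglyConvex

variable {d : ℕ} {α : ℝ} {f : E d → ℝ} {p : E d}

lemma IsStronglyConvex.sub_ge (hf : IsStronglyConvex α f) (hp : gradient f p = 0) (z : E d) :
    α / 2 * ‖z - p‖ ^ 2 ≤ f z - f p := by
  have := hf p z
  rw [hp, inner_zero_left, norm_sub_rev] at this
  linarith

lemma IsStronglyConvex.le_of_gradient_eq_zero (hf : IsStronglyConvex α f) (hα : 0 ≤ α)
    (hp : gradient f p = 0) (z : E d) : f p ≤ f z := by
  have := hf.sub_ge hp z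
  have : 0 ≤ α / 2 * ‖z - p‖ ^ 2 := by positivity
  linarith

lemma IsStronglyConvex.iInf_eq (hf : IsStronglyConvex α f) (hα : 0 ≤ α)
    (hp : gradient f p = 0) : ⨅ x, f x = f p :=
  le_antisymm (ciInf_le ⟨f p, by rintro _ ⟨z, rfl⟩; exact hf.le_of_gradient_eq_zero hα hp z⟩ p)
    (le_ciInf fun z => hf.le_of_gradient_eq_zero hα hp z)

lemma IsStronglyConvex.minimizer_eq (hf : IsStronglyConvex α f) (hα : 0 < α)
    (hp : gradient f p = 0) (hpb : p ∈ unitBall d) : minimizer f = p := by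
  have hspec : minimizer f ∈ unitBall d ∧ IsMinOn f (unitBall d) (minimizer f) :=
    Classical.epsilon_spec (p := fun x => x ∈ unitBall d ∧ IsMinOn f (unitBall d) x)
      ⟨p, hpb, fun z _ => hf.le_of_gradient_eq_zero hα.le hp z⟩
  have h1 : f (minimizer f) ≤ f p := hspec.2 hpb
  have h2 := hf.sub_ge hp (minimizer f)
  have h3 : ‖minimizer f - p‖ ^ 2 ≤ 0 := by
    by_contra! h
    nlinarith
  have h4 : ‖minimizer f - p‖ = 0 := pow_eq_zero_iff two_ne_zero |>.mp (h3.antisymm (sq_nonneg _))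
  exact sub_eq_zero.mp (norm_eq_zero.mp h4)

lemma IsStronglyConvex.mono {α' : ℝ} (hf : IsStronglyConvex α' f) (h : α ≤ α') :
    IsStronglyConvex α f := fun x y => by
  have h1 : α / 2 * ‖x - y‖ ^ 2 ≤ α' / 2 * ‖x - y‖ ^ 2 := by gcongr
  linarith [hf x y]

/-- Lower bounds proved for a larger strong convexity parameter pass to the smaller one. -/
lemma targetClass_subset {α' β L G : ℝ} (h : α ≤ α') :
    targetClass d α' β L G ⊆ targetClass d α β L G :=
  fun _ hf => ⟨hf.1, hf.2.1.mono h, hf.2.2⟩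

end StronglyConvex

/-- The sign `1` or `-1` given by a Boolean. -/
noncomputable def signOf (b : Bool) : ℝ := if b then 1 else -1

lemma signOf_eq_or (b : Bool) : signOf b = 1 ∨ signOf b = -1 := by
  cases b <;> simp [signOf]

lemma abs_signOf (b : Bool) : |signOf b| = 1 := by
  cases b <;> simp [signOf]

/-! ### The hard functions: membership in the class, minimizers, mutual distance. -/

section HardFunctions

variable {d : ℕ}

/-- The functions that are hard to tell apart: quadratic functions with a sine wave of
amplitude `c` and wave length `2 π h` in each coordinate, added or subtracted. -/
noncomputable def hardFun (A c h : ℝ) (b : Fin d → Bool) : E d → ℝ :=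
  separable fun i => coordFun A (signOf (b i) * c) h

lemma contDiff_hardFun (A c h : ℝ) (b : Fin d → Bool) {n : WithTop ℕ∞} :
    ContDiff ℝ n (hardFun A c h b) :=
  contDiff_separable fun _ => contDiff_coordFun _ _ _

lemma gradient_hardFun (A c h : ℝ) (b : Fin d → Bool) (x : E d) :
    gradient (hardFun A c h b) x =
      WithLp.toLp 2 fun i => A * x i + signOf (b i) * c / h * Real.cos (x i / h) :=
  gradient_separable (fun _ _ => hasDerivAt_coordFun _ _ _ _) x

lemma isStronglyConvex_hardFun {A c h α : ℝ} (hc : 0 ≤ c) (hh : 0 < h) (hcA : c / h ^ 2 ≤ A - α)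
    (b : Fin d → Bool) : IsStronglyConvex α (hardFun A c h b) := by
  intro x y
  rw [gradient_hardFun, PiLp.inner_apply, norm_sub_rev, EuclideanSpace.norm_sq_eq, Finset.mul_sum]
  simp only [hardFun, separable]
  rw [← Finset.sum_add_distrib, ← Finset.sum_add_distrib]
  refine Finset.sum_le_sum fun i _ => ?_
  have := coordFun_strongly_convex (A := A) (c := signOf (b i) * c) (α := α) hh
    (by rwa [abs_mul, abs_signOf, one_mul, abs_of_nonneg hc]) (x i) (y i)
  simpa [mul_comm] using this

lemma hardFun_mem_holderClass {A c h β L : ℝ} (hA : 0 ≤ A) (hc : 0 ≤ c) (hh : 0 < h)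
    (hβ : 2 ≤ β) (hL : 2 * c / h ^ β ≤ L) (hL2 : β = 2 → A / 2 + 2 * c / h ^ β ≤ L)
    (b : Fin d → Bool) : hardFun A c h b ∈ holderClass d β L := by
  have hL0 : 0 ≤ L := le_trans (by positivity) hL
  have hceil : 2 ≤ ⌈β⌉₊ := by
    have : (2 : ℝ) ≤ ⌈β⌉₊ := hβ.trans (Nat.le_ceil β)
    exact_mod_cast this
  have hcast : ((holderOrder β : ℕ) : ℝ) + 1 = ⌈β⌉₊ := by
    rw [holderOrder]
    exact_mod_cast Nat.sub_add_cancel (by omega : 1 ≤ ⌈β⌉₊)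
  have hn : 1 ≤ holderOrder β := by rw [holderOrder]; omega
  have hn2 : β ≤ holderOrder β + 1 := hcast ▸ Nat.le_ceil β
  have hn1 : (holderOrder β : ℝ) < β := by
    have := Nat.ceil_lt_add_one (by linarith : 0 ≤ β)
    linarith
  refine ⟨fun k _ => ?_, fun x _ z _ => ?_⟩
  · exact (contDiff_hardFun A c h b (n := k + 1)).differentiable_iteratedFDeriv
      (by exact_mod_cast Nat.lt_succ_self k)
  · rw [hardFun, taylorPoly_separable fun i => contDiff_coordFun _ _ _, separable,
      ← Finset.sum_sub_distrib]
    have habs (i : Fin d) : |signOf (b i) * c| = c := by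
      rw [abs_mul, abs_signOf, one_mul, abs_of_nonneg hc]
    calc _ ≤ ∑ i, L * |z i - x i| ^ β := by
          refine (Finset.abs_sum_le_sum_abs _ _).trans (Finset.sum_le_sum fun i _ => ?_)
          refine abs_coordFun_sub_taylorPolyReal_le hA hh hn hn1 hn2 (fun h1 => ?_)
            (by rwa [habs]) _ _
          have hβ2 : β = 2 := by
            rw [h1] at hn2
            norm_num at hn2
            linarith
          exact ⟨hβ2, by rw [habs]; exact hL2 hβ2⟩
      _ = L * ∑ i, |(z - x) i| ^ β := by rw [Finset.mul_sum]; rfl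
      _ ≤ L * ‖z - x‖ ^ β := by gcongr; exact sum_abs_rpow_le hβ _

lemma norm_toLp_le_sqrt_mul {v : Fin d → ℝ} {r : ℝ} (hr : 0 ≤ r) (hv : ∀ i, |v i| ≤ r) :
    ‖(WithLp.toLp 2 v : E d)‖ ≤ Real.sqrt d * r := by
  refine le_of_sq_le_sq ?_ (by positivity)
  rw [EuclideanSpace.norm_sq_eq, mul_pow, Real.sq_sqrt (Nat.cast_nonneg d)]
  calc ∑ i, ‖v i‖ ^ 2 ≤ ∑ _i : Fin d, r ^ 2 := by
        refine Finset.sum_le_sum fun i _ => ?_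
        exact pow_le_pow_left₀ (norm_nonneg _) (hv i) 2
    _ = d * r ^ 2 := by simp

lemma norm_gradient_hardFun_le {A c h : ℝ} (hA : 0 ≤ A) (hc : 0 ≤ c) (hh : 0 < h)
    (b : Fin d → Bool) {x : E d} (hx : x ∈ unitBall d) :
    ‖gradient (hardFun A c h b) x‖ ≤ A + Real.sqrt d * (c / h) := by
  have hx' : ‖x‖ ≤ 1 := by simpa [unitBall] using hx
  have hsplit : gradient (hardFun A c h b) x =
      A • x + WithLp.toLp 2 fun i => signOf (b i) * c / h * Real.cos (x i / h) := by
    rw [gradient_hardFun]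
    rfl
  rw [hsplit]
  refine (norm_add_le _ _).trans (add_le_add ?_ ?_)
  · rw [norm_smul, Real.norm_of_nonneg hA]
    exact mul_le_of_le_one_right hA hx'
  · refine norm_toLp_le_sqrt_mul (by positivity) fun i => ?_
    rw [abs_mul, abs_div, abs_mul, abs_signOf, one_mul, abs_of_nonneg hc, abs_of_pos hh]
    exact mul_le_of_le_one_right (by positivity) (Real.abs_cos_le_one _)

/-- The critical point of a hard function, when `u` is its distance to `0` along each axis. -/
noncomputable def hardPoint (u : ℝ) (b : Fin d → Bool) : E d :=
  WithLp.toLp 2 fun i => -(signOf (b i) * u)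

/-- The cosine is even, so one equation for `u` serves both signs in every coordinate. -/
lemma gradient_hardFun_hardPoint {A c h u : ℝ} (hu : A * u = c / h * Real.cos (u / h))
    (b : Fin d → Bool) : gradient (hardFun A c h b) (hardPoint u b) = 0 := by
  rw [gradient_hardFun]
  ext i
  have hcos : Real.cos (-(signOf (b i) * u) / h) = Real.cos (u / h) := by
    rcases signOf_eq_or (b i) with h | h <;> simp [h, neg_div]
  simp only [hardPoint, hcos, PiLp.zero_apply]
  linear_combination (-signOf (b i)) * hu

lemma hardPoint_mem_unitBall {u : ℝ} (hu : 0 ≤ u) (hd : Real.sqrt d * u ≤ 1)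
    (b : Fin d → Bool) : hardPoint u b ∈ unitBall d := by
  rw [unitBall, mem_closedBall_zero_iff]
  refine (norm_toLp_le_sqrt_mul hu fun i => ?_).trans hd
  rw [abs_neg, abs_mul, abs_signOf, one_mul, abs_of_nonneg hu]

lemma abs_hardFun_sub_hardFun_update_le {A c h : ℝ} (hc : 0 ≤ c) (b : Fin d → Bool) (i : Fin d)
    (β : Bool) (x : E d) :
    |hardFun A c h b x - hardFun A c h (Function.update b i β) x| ≤ 2 * c := by
  simp only [hardFun, separable]
  rw [← Finset.sum_sub_distrib, Finset.sum_eq_single_of_mem i (Finset.mem_univ i) fun j _ hj => by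
    rw [Function.update_of_ne hj, sub_self]]
  simp only [coordFun, wave, add_sub_add_left_eq_sub]
  have hb (β : Bool) : |signOf β * c * Real.sin (x i / h)| ≤ c := by
    rw [abs_mul, abs_mul, abs_signOf, one_mul, abs_of_nonneg hc]
    exact mul_le_of_le_one_right hc (Real.abs_sin_le_one _)
  refine (abs_sub _ _).trans ?_
  linarith [hb (b i), hb (Function.update b i β i)]

end HardFunctions

/-! ### Assouad's argument over the signs. -/

section Assouad

variable {d : ℕ} {Ω : Type*}

/-- The event that the sign of the `i`-th coordinate of `hardPoint u b` is not the one of `X`. -/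
def signError (X : Ω → E d) (b : Fin d → Bool) (i : Fin d) : Set Ω :=
  {ω | X ω ∈ {x : E d | 0 ≤ x i} ↔ b i = true}

lemma measurableSet_nonneg_coord (i : Fin d) : MeasurableSet {x : E d | 0 ≤ x i} :=
  measurableSet_le measurable_const (EuclideanSpace.proj (𝕜 := ℝ) i).continuous.measurable

lemma measurableSet_signError [MeasurableSpace Ω] {X : Ω → E d} (hX : Measurable X) (b : Fin d → Bool) (i : Fin d) :
    MeasurableSet (signError X b i) := by
  have h := hX (measurableSet_nonneg_coord i)
  cases hb : b i with
  | true => simpa [signError, hb] using h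
  | false =>
    simp only [signError, hb, Bool.false_eq_true, iff_false]
    exact h.compl

/-- The sign `true` puts the minimizer at `-u`. An estimate on the other side of `0` is at least `u`
away. -/
lemma sq_le_of_mem_signError {X : Ω → E d} {b : Fin d → Bool} {i : Fin d} {u : ℝ} (hu : 0 ≤ u)
    {ω : Ω} (hω : ω ∈ signError X b i) : u ^ 2 ≤ ((X ω - hardPoint u b) i) ^ 2 := by
  have hcoord : (X ω - hardPoint u b) i = X ω i + signOf (b i) * u := by
    simp [hardPoint]
  rw [hcoord]
  simp only [signError, Set.mem_ofPred_eq] at hω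
  cases hb : b i with
  | true =>
    have := hω.mpr hb
    simp only [signOf, if_true]
    nlinarith
  | false =>
    have : X ω i < 0 := by
      by_contra! h
      simpa [hb] using hω.mp h
    simp only [signOf, Bool.false_eq_true, if_false]
    nlinarith

variable [MeasurableSpace Ω] {P : Measure Ω} [IsProbabilityMeasure P]

lemma ofReal_sq_mul_sum_le_lintegral {X : Ω → E d} (hX : Measurable X) (b : Fin d → Bool)
    {u : ℝ} (hu : 0 ≤ u) :
    ENNReal.ofReal (u ^ 2 * ∑ i, P.real (signError X b i)) ≤
      ∫⁻ ω, ENNReal.ofReal (‖X ω - hardPoint u b‖ ^ 2) ∂P := by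
  calc _ = ∑ i, ENNReal.ofReal (u ^ 2) * P (signError X b i) := by
        rw [Finset.mul_sum, ENNReal.ofReal_sum_of_nonneg fun i _ => by positivity]
        refine Finset.sum_congr rfl fun i _ => ?_
        rw [ENNReal.ofReal_mul (by positivity), ofReal_measureReal]
    _ = ∑ i, ∫⁻ ω, (signError X b i).indicator (fun _ => ENNReal.ofReal (u ^ 2)) ω ∂P := by
        refine Finset.sum_congr rfl fun i _ => ?_
        rw [lintegral_indicator_const (measurableSet_signError hX b i)]
    _ = ∫⁻ ω, ∑ i, (signError X b i).indicator (fun _ => ENNReal.ofReal (u ^ 2)) ω ∂P := by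
        rw [lintegral_finsetSum]
        exact fun i _ => measurable_const.indicator (measurableSet_signError hX b i)
    _ ≤ _ := by
        refine lintegral_mono fun ω => ?_
        rw [EuclideanSpace.norm_sq_eq, ENNReal.ofReal_sum_of_nonneg fun i _ => by positivity]
        refine Finset.sum_le_sum fun i _ => ?_
        by_cases hω : ω ∈ signError X b i
        · rw [Set.indicator_of_mem hω, Real.norm_eq_abs, sq_abs]
          exact ENNReal.ofReal_le_ofReal (sq_le_of_mem_signError hu hω)
        · rw [Set.indicator_of_notMem hω]
          exact zero_le

/-- The averaging step of Assouad's lemma. -/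
lemma exists_le_sum_of_pairwise {p : (Fin d → Bool) → Fin d → ℝ} {r : ℝ}
    (hp : ∀ b i, r ≤ p b i + p (Function.update b i (!b i)) i) :
    ∃ b, d * (r / 2) ≤ ∑ i, p b i := by
  -- Flipping the `i`-th sign permutes all sign vectors, so both terms of the hypothesis have the
  -- same sum over `b`.
  have hflip (i : Fin d) : Function.Involutive
      fun b : Fin d → Bool => Function.update b i (!b i) := fun b => by simp
  have hsum (i : Fin d) : ∑ _b : Fin d → Bool, r / 2 ≤ ∑ b, p b i := by
    have h1 : ∑ b, p (Function.update b i (!b i)) i = ∑ b, p b i :=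
      Equiv.sum_comp (hflip i).toPerm fun b => p b i
    have h2 : ∑ _b : Fin d → Bool, r ≤ ∑ b, (p b i + p (Function.update b i (!b i)) i) :=
      Finset.sum_le_sum fun b _ => hp b i
    rw [Finset.sum_add_distrib, h1] at h2
    rw [← Finset.sum_div]
    linarith
  have htot : ∑ _b : Fin d → Bool, d * (r / 2) ≤ ∑ b, ∑ i, p b i := by
    rw [Finset.sum_comm]
    calc _ = ∑ _i : Fin d, ∑ _b : Fin d → Bool, r / 2 := by
          simp only [Finset.sum_const, Finset.card_univ, nsmul_eq_mul, Fintype.card_fin]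
          ring
      _ ≤ _ := Finset.sum_le_sum fun i _ => hsum i
  obtain ⟨b, -, hb⟩ := Finset.exists_le_of_sum_le Finset.univ_nonempty htot
  exact ⟨b, hb⟩

variable {z₁ : Ω → E d} {ξ : ℕ → Ω → ℝ} {ν : Measure ℝ} [IsProbabilityMeasure ν]

lemma quarter_le_signError_add (S : Strategy d) {f : (Fin d → Bool) → E d → ℝ}
    (hf : ∀ b, Measurable (f b)) (hz : Measurable z₁) (hξ : ∀ t, Measurable (ξ t)) {n : ℕ}
    (hlaw : ∀ t < n, P.map (ξ t) = ν)
    (hind : ∀ t < n, IndepFun (fun ω => (z₁ ω, fun s => if s < t then ξ s ω else 0)) (ξ t) P)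
    {K : ℝ} (hK : 0 ≤ K) (hnK : n * K ≤ 1 / 2)
    (hKL : ∀ b i β x, InformationTheory.klDiv ν
      (ν.map fun u => u - (f b x - f (Function.update b i β) x)) ≤ ENNReal.ofReal K)
    (b : Fin d → Bool) (i : Fin d) :
    1 / 4 ≤ P.real (signError (fun ω => query S (f b) (z₁ ω) (fun s => ξ s ω) n) b i) +
      P.real (signError
        (fun ω => query S (f (Function.update b i (!b i))) (z₁ ω) (fun s => ξ s ω) n)
        (Function.update b i (!b i)) i) := by
  have key (b : Fin d → Bool) (hb : b i = false) :
      1 / 4 ≤ P.real (signError (fun ω => query S (f b) (z₁ ω) (fun s => ξ s ω) n) b i) +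
      P.real (signError
        (fun ω => query S (f (Function.update b i true)) (z₁ ω) (fun s => ξ s ω) n)
        (Function.update b i true) i) := by
    have := quarter_le_error_sum S (hf b) (hf (Function.update b i true)) hz hξ hlaw hind hK hnK
      (hKL b i true) (measurableSet_nonneg_coord i)
    simpa only [signError, hb, Bool.false_eq_true, iff_false, Function.update_self, iff_true]
      using this
  cases hb : b i with
  | false => simpa [hb] using key b hb
  | true =>
    have := key (Function.update b i false) (by simp)
    rw [Function.update_idem, show Function.update b i true = b by
      rw [← hb, Function.update_eq_self], add_comm] at this
    simpa [hb] using this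

lemma exists_hardFun_le_lintegral (S : Strategy d) (hz : Measurable z₁)
    (hξ : ∀ t, Measurable (ξ t)) {n : ℕ} (hlaw : ∀ t < n, P.map (ξ t) = ν)
    (hind : ∀ t < n, IndepFun (fun ω => (z₁ ω, fun s => if s < t then ξ s ω else 0)) (ξ t) P)
    {A c h I₀ u : ℝ} {v₀ : ℝ≥0∞} (hν : NoiseCondition ν I₀ v₀) (hI₀ : 0 ≤ I₀) (hc : 0 ≤ c)
    (hcv : ENNReal.ofReal (2 * c) < v₀) (hn : n * (I₀ * (2 * c) ^ 2) ≤ 1 / 2) (hu : 0 ≤ u) :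
    ∃ b : Fin d → Bool, ENNReal.ofReal (u ^ 2 * (d / 8)) ≤
      ∫⁻ ω, ENNReal.ofReal (‖query S (hardFun A c h b) (z₁ ω) (fun s => ξ s ω) n -
        hardPoint u b‖ ^ 2) ∂P := by
  have hmeas (b : Fin d → Bool) : Measurable (hardFun A c h b) :=
    (contDiff_hardFun A c h b (n := 0)).continuous.measurable
  have hKL (b : Fin d → Bool) (i : Fin d) (β : Bool) (x : E d) : InformationTheory.klDiv ν
      (ν.map fun u => u - (hardFun A c h b x - hardFun A c h (Function.update b i β) x)) ≤
      ENNReal.ofReal (I₀ * (2 * c) ^ 2) := by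
    have habs := abs_hardFun_sub_hardFun_update_le (A := A) (h := h) hc b i β x
    refine (hν _ ((ENNReal.ofReal_le_ofReal habs).trans_lt hcv)).trans ?_
    refine ENNReal.ofReal_le_ofReal (mul_le_mul_of_nonneg_left ?_ hI₀)
    rw [← sq_abs]
    exact pow_le_pow_left₀ (abs_nonneg _) habs 2
  obtain ⟨b, hb⟩ := exists_le_sum_of_pairwise (r := 1 / 4)
    (quarter_le_signError_add (P := P) S hmeas hz hξ hlaw hind (by positivity) hn hKL)
  refine ⟨b, le_trans (ENNReal.ofReal_le_ofReal ?_)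
    (ofReal_sq_mul_sum_le_lintegral (measurable_query_comp S (hmeas b) hz hξ n) b hu)⟩
  refine mul_le_mul_of_nonneg_left (le_trans (le_of_eq ?_) hb) (sq_nonneg _)
  ring

/-- The lower bounds that a family of hard functions gives. -/
lemma lower_bounds_of_hardFun (S : Strategy d) (hz : Measurable z₁)
    (hξ : ∀ t, Measurable (ξ t)) {n : ℕ} (hlaw : ∀ t < n, P.map (ξ t) = ν)
    (hind : ∀ t < n, IndepFun (fun ω => (z₁ ω, fun s => if s < t then ξ s ω else 0)) (ξ t) P)
    {A c h I₀ α β L G : ℝ} {v₀ : ℝ≥0∞} (hν : NoiseCondition ν I₀ v₀) (hI₀ : 0 ≤ I₀) (hc : 0 < c)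
    (hcv : ENNReal.ofReal (2 * c) < v₀) (hn : n * (I₀ * (2 * c) ^ 2) ≤ 1 / 2)
    (hα : 0 < α) (hA : 0 < A) (hh : 0 < h) (hβ : 2 ≤ β) (hcA : c / h ^ 2 ≤ A - α)
    (hL : 2 * c / h ^ β ≤ L) (hL2 : β = 2 → A / 2 + 2 * c / h ^ β ≤ L)
    (hG : A + Real.sqrt d * (c / h) ≤ G) (hd : Real.sqrt d * (c / (h * A)) ≤ 1) :
    ENNReal.ofReal (α / 2 * ((c / (2 * (h * A))) ^ 2 * (d / 8))) ≤
        ⨆ f ∈ targetClass d α β L G, ∫⁻ ω, ENNReal.ofReal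
          (f (query S f (z₁ ω) (fun s => ξ s ω) n) - ⨅ x, f x) ∂P ∧
      ENNReal.ofReal ((c / (2 * (h * A))) ^ 2 * (d / 8)) ≤
        ⨆ f ∈ targetClass d α β L G, ∫⁻ ω, ENNReal.ofReal
          (‖query S f (z₁ ω) (fun s => ξ s ω) n - minimizer f‖ ^ 2) ∂P := by
  obtain ⟨u, hu0, hu1, hu2, hu⟩ := exists_critical_point hA hc hh (by linarith)
  obtain ⟨b, hb⟩ := exists_hardFun_le_lintegral (A := A) (h := h) S hz hξ hlaw hind hν hI₀ hc.le
    hcv hn hu0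
  have hconv := isStronglyConvex_hardFun hc.le hh hcA b
  have hgrad := gradient_hardFun_hardPoint hu b
  have hball : hardPoint u b ∈ unitBall d :=
    hardPoint_mem_unitBall hu0 (le_trans (by gcongr) hd) b
  have hmem : hardFun A c h b ∈ targetClass d α β L G :=
    ⟨hardFun_mem_holderClass hA.le hc.le hh hβ hL hL2 b, hconv,
      fun x hx => (norm_gradient_hardFun_le hA.le hc.le hh b hx).trans hG,
      hardPoint u b, hball, hconv.le_of_gradient_eq_zero hα.le hgrad⟩
  have hle : (c / (2 * (h * A))) ^ 2 * (d / 8) ≤ u ^ 2 * (d / 8) := by gcongr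
  constructor
  · refine le_trans ?_ (le_iSup₂_of_le _ hmem le_rfl)
    rw [hconv.iInf_eq hα.le hgrad]
    calc _ ≤ ENNReal.ofReal (α / 2 * (u ^ 2 * (d / 8))) :=
          ENNReal.ofReal_le_ofReal (by gcongr)
      _ ≤ ENNReal.ofReal (α / 2) * ∫⁻ ω, ENNReal.ofReal
            (‖query S (hardFun A c h b) (z₁ ω) (fun s => ξ s ω) n - hardPoint u b‖ ^ 2) ∂P := by
          rw [ENNReal.ofReal_mul (by positivity)]
          gcongr
      _ = ∫⁻ ω, ENNReal.ofReal (α / 2 *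
            ‖query S (hardFun A c h b) (z₁ ω) (fun s => ξ s ω) n - hardPoint u b‖ ^ 2) ∂P := by
          rw [← lintegral_const_mul' _ _ ENNReal.ofReal_ne_top]
          simp only [ENNReal.ofReal_mul (by positivity : 0 ≤ α / 2)]
      _ ≤ _ := lintegral_mono fun ω => ENNReal.ofReal_le_ofReal (hconv.sub_ge hgrad _)
  · refine le_trans ?_ (le_iSup₂_of_le _ hmem le_rfl)
    rw [hconv.minimizer_eq hα hgrad hball]
    exact (ENNReal.ofReal_le_ofReal hle).trans hb

end Assouad

/-! ### Choice of parameters and comparison of rates. -/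

/-- Two constraints bind: `h ≤ T ^ (-1 / (2 * β))`, for the information and the curvature, and `√d *
h ^ (β - 1) ≤ a`, which keeps the minimizers in the ball and the gradients small. The largest `h`
allowed by both is taken. -/
lemma exists_bandwidth {β a : ℝ} {d T : ℕ} (hβ : 2 ≤ β) (ha : 0 < a) (hd : 0 < d) (hT : 0 < T) :
    ∃ h : ℝ, 0 < h ∧ h ≤ 1 ∧ (h ^ β) ^ 2 ≤ 1 / T ∧
      h ^ (β - 2) ≤ (T : ℝ) ^ (-(1 / 2) + 1 / β) ∧ Real.sqrt d * h ^ (β - 1) ≤ a ∧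
      (h ^ (β - 1)) ^ 2 = min (a ^ 2 / d) ((T : ℝ) ^ (-((β - 1) / β))) := by
  have hd' : (0 : ℝ) < d := by exact_mod_cast hd
  have hT0 : (0 : ℝ) < T := by exact_mod_cast hT
  have hT1 : (1 : ℝ) ≤ T := by exact_mod_cast hT
  have hβ0 : 0 < β := by linarith
  have hβ1 : 0 < β - 1 := by linarith
  set m := min (a ^ 2 / d) ((T : ℝ) ^ (-((β - 1) / β))) with hm
  have hm0 : 0 < m := by positivity
  set h := m ^ (1 / (2 * (β - 1))) with hh
  have hh0 : 0 < h := by positivity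
  have hhT : h ≤ (T : ℝ) ^ (-(1 / (2 * β))) := by
    calc h ≤ ((T : ℝ) ^ (-((β - 1) / β))) ^ (1 / (2 * (β - 1))) := by
          rw [hh]
          exact Real.rpow_le_rpow hm0.le (min_le_right _ _) (by positivity)
      _ = _ := by
          rw [← Real.rpow_mul hT0.le]
          congr 1
          field_simp
  have hsq : (h ^ (β - 1)) ^ 2 = m := by
    rw [hh, ← Real.rpow_natCast, ← Real.rpow_mul hm0.le, ← Real.rpow_mul hm0.le]
    convert Real.rpow_one m using 2
    push_cast
    field_simp
  refine ⟨h, hh0, hhT.trans (Real.rpow_le_one_of_one_le_of_nonpos hT1 ?_), ?_, ?_, ?_, hsq⟩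
  · rw [neg_nonpos]; positivity
  · calc (h ^ β) ^ (2 : ℕ) ≤ (((T : ℝ) ^ (-(1 / (2 * β)))) ^ β) ^ (2 : ℕ) := by gcongr
      _ = 1 / (T : ℝ) := by
          rw [← Real.rpow_mul hT0.le, ← Real.rpow_natCast, ← Real.rpow_mul hT0.le, one_div (T : ℝ),
            ← Real.rpow_neg_one (T : ℝ)]
          congr 1
          push_cast
          field_simp
  · calc h ^ (β - 2) ≤ ((T : ℝ) ^ (-(1 / (2 * β)))) ^ (β - 2) :=
          Real.rpow_le_rpow hh0.le hhT (by linarith)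
      _ = _ := by
          rw [← Real.rpow_mul hT0.le]
          congr 1
          field_simp
          ring
  · refine le_of_sq_le_sq ?_ ha.le
    rw [mul_pow, Real.sq_sqrt hd'.le, hsq]
    calc d * m ≤ d * (a ^ 2 / d) := by gcongr; exact min_le_left _ _
      _ = a ^ 2 := by field_simp

/-- Strong convexity below the threshold `T ^ (-1/2 + 1/β)` does not help: the target rates are
dominated by those at the strong convexity parameter `a` when that exceeds the threshold. -/
lemma rates_le {β α a c₀ : ℝ} {d T : ℕ} (hβ : 2 ≤ β) (hT : 0 < T) (hα : 0 < α) (hc₀ : 0 < c₀)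
    (hc₁ : c₀ ≤ 1) (ha : a = max α (c₀ * (T : ℝ) ^ (-(1 / 2) + 1 / β))) :
    c₀ * min (max α ((T : ℝ) ^ (-(1 / 2) + 1 / β)))
        (min ((d : ℝ) / Real.sqrt T) ((d : ℝ) / α * (T : ℝ) ^ (-((β - 1) / β)))) ≤
      min a (d / a * (T : ℝ) ^ (-((β - 1) / β))) ∧
    min 1 (min ((d : ℝ) / (T : ℝ) ^ (1 / β)) ((d : ℝ) / α ^ 2 * (T : ℝ) ^ (-((β - 1) / β)))) ≤
      min 1 (d / a ^ 2 * (T : ℝ) ^ (-((β - 1) / β))) := by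
  have hT0 : (0 : ℝ) < T := by exact_mod_cast hT
  have hd0 : (0 : ℝ) ≤ d := Nat.cast_nonneg d
  have hβ0 : 0 < β := by linarith
  set τ := (T : ℝ) ^ (-(1 / 2) + 1 / β) with hτ
  set r := (T : ℝ) ^ (-((β - 1) / β)) with hr
  have hτ0 : 0 < τ := by positivity
  have hr0 : 0 < r := by positivity
  have hrτ : r = τ * (1 / Real.sqrt T) := by
    rw [one_div (Real.sqrt T), Real.sqrt_eq_rpow, ← Real.rpow_neg hT0.le, hτ, hr, ← Real.rpow_add hT0]
    congr 1
    field_simp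
    ring
  have hrτ2 : r = τ ^ 2 * (1 / (T : ℝ) ^ (1 / β)) := by
    rw [one_div ((T : ℝ) ^ (1 / β)), ← Real.rpow_neg hT0.le, hτ, hr, ← Real.rpow_natCast,
      ← Real.rpow_mul hT0.le, ← Real.rpow_add hT0]
    congr 1
    push_cast
    field_simp
    ring
  have ha0 : 0 < a := by rw [ha]; positivity
  have hmax : c₀ * max α τ ≤ a := by
    rw [ha, mul_max_of_nonneg _ _ hc₀.le]
    exact max_le_max (mul_le_of_le_one_left hα.le hc₁) le_rfl
  rcases max_choice α (c₀ * τ) with h | h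
  · have haα : a = α := ha.trans h
    rw [haα] at hmax ⊢
    constructor
    · refine le_min ((mul_le_mul_of_nonneg_left (min_le_left _ _) hc₀.le).trans hmax) ?_
      calc _ ≤ 1 * (d / α * r) := by
            gcongr
            exact (min_le_right _ _).trans (min_le_right _ _)
        _ = _ := one_mul _
    · exact min_le_min le_rfl (min_le_right _ _)
  · have haτ : a = c₀ * τ := ha.trans h
    constructor
    · refine le_min ((mul_le_mul_of_nonneg_left (min_le_left _ _) hc₀.le).trans hmax) ?_
      calc _ ≤ c₀ * (d / Real.sqrt T) := by
            gcongr
            exact (min_le_right _ _).trans (min_le_left _ _)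
        _ ≤ 1 / c₀ * (d / Real.sqrt T) := by
            gcongr
            exact hc₁.trans ((one_le_div hc₀).mpr hc₁)
        _ = d / a * r := by
            rw [haτ, hrτ]
            field_simp
    · refine min_le_min le_rfl ((min_le_left _ _).trans ?_)
      calc d / (T : ℝ) ^ (1 / β) = 1 * (d / (T : ℝ) ^ (1 / β)) := (one_mul _).symm
        _ ≤ 1 / c₀ ^ 2 * (d / (T : ℝ) ^ (1 / β)) := by
            gcongr
            exact (one_le_div (by positivity)).mpr (pow_le_one₀ hc₀.le hc₁)
        _ = d / a ^ 2 * r := by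
            rw [haτ, hrτ2]
            field_simp

/-- The constants of the construction: the amplitude `ρ` of the perturbation, the relative excess
`δ` of the curvature, and the ratio `c₀` in the threshold for the strong convexity parameter. -/
lemma exists_constants {β L G κ I₀ : ℝ} {v₀ : ℝ≥0∞} (hL : 0 < L) (hκ : κ < 2) (hI₀ : 0 < I₀)
    (hv₀ : 0 < v₀) (hG : 0 < G) (hκ0 : β = 2 → 0 < κ) :
    ∃ c₀ δ ρ : ℝ, 0 < c₀ ∧ c₀ ≤ 1 ∧ 2 * c₀ ≤ G ∧ (β = 2 → c₀ ≤ κ * L) ∧ 0 < δ ∧ δ ≤ 1 / 2 ∧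
      0 < ρ ∧ ρ ≤ δ * c₀ ∧ 2 * ρ ≤ L ∧ (β = 2 → (1 + δ) * (κ * L) / 2 + 2 * ρ ≤ L) ∧
      ENNReal.ofReal (2 * ρ) < v₀ ∧ I₀ * (2 * ρ) ^ 2 ≤ 1 / 2 := by
  obtain ⟨c₀, h1, h2, h3, h4⟩ :
      ∃ c₀ : ℝ, 0 < c₀ ∧ c₀ ≤ 1 ∧ 2 * c₀ ≤ G ∧ (β = 2 → c₀ ≤ κ * L) := by
    by_cases hβ : β = 2
    · have hκ1 := hκ0 hβ
      refine ⟨min (min 1 (G / 2)) (κ * L), by positivity, ?_, ?_, fun _ => min_le_right _ _⟩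
      · exact (min_le_left _ _).trans (min_le_left _ _)
      · linarith [(min_le_left (min 1 (G / 2)) (κ * L)).trans (min_le_right _ _)]
    · refine ⟨min 1 (G / 2), by positivity, min_le_left _ _, ?_, fun h => absurd h hβ⟩
      linarith [min_le_right 1 (G / 2)]
  obtain ⟨r, hr0, hrv⟩ := ENNReal.lt_iff_exists_nnreal_btwn.mp hv₀
  have hr0' : (0 : ℝ) < r := by exact_mod_cast hr0
  have hκ' : 0 < 2 - κ := by linarith
  set δ := min (1 / 2) ((2 - κ) / 4) with hδ
  have hδ0 : 0 < δ := by positivity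
  have hδ1 : δ ≤ 1 / 2 := min_le_left _ _
  have hδ2 : δ ≤ (2 - κ) / 4 := min_le_right _ _
  obtain ⟨ρ, hρ0, hρ1, hρ2, hρ3, hρ4, hρ5, hρ6⟩ : ∃ ρ : ℝ, 0 < ρ ∧ ρ ≤ 1 ∧ ρ ≤ δ * c₀ ∧
      ρ ≤ L / 2 ∧ ρ ≤ (2 - κ) * L / 8 ∧ ρ ≤ r / 2 ∧ ρ ≤ 1 / (8 * I₀) := by
    refine ⟨min 1 (min (δ * c₀) (min (L / 2) (min ((2 - κ) * L / 8) (min (r / 2) (1 / (8 * I₀)))))),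
      by positivity, ?_, ?_, ?_, ?_, ?_, ?_⟩ <;> simp only [min_le_iff, le_refl, true_or, or_true]
  refine ⟨c₀, δ, ρ, h1, h2, h3, h4, hδ0, hδ1, hρ0, hρ2, by linarith, fun hβ => ?_, ?_, ?_⟩
  · have hκ1 := hκ0 hβ
    have h5 : δ * κ ≤ (2 - κ) / 4 * 2 := by gcongr
    have h6 : δ * κ * L ≤ (2 - κ) / 4 * 2 * L := by gcongr
    -- The slack `(2 - κ) * L / 2` is shared equally between the excess curvature and the wave.
    nlinarith
  · refine lt_of_le_of_lt ?_ hrv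
    rw [← ENNReal.ofReal_coe_nnreal]
    exact ENNReal.ofReal_le_ofReal (by linarith)
  · calc I₀ * (2 * ρ) ^ 2 = 4 * I₀ * (ρ * ρ) := by ring
      _ ≤ 4 * I₀ * (1 * (1 / (8 * I₀))) := by gcongr
      _ = 1 / 2 := by field_simp; norm_num

end ZeroOrder

/-! ### Assembly of the lower bounds. -/

theorem theorem5 (β L G κ I₀ : ℝ) (v₀ : ℝ≥0∞)
    (hβ : 2 ≤ β) (hL : 0 < L) (hκ : κ < 2) (hI₀ : 0 < I₀) (hv₀ : 0 < v₀) :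
    ∃ C : ℝ, 0 < C ∧
      ∀ (d T : ℕ) (α : ℝ), 2 ≤ T → 0 < α → 2 * α < G → (β = 2 → α ≤ κ * L) →
      ∀ (ν : Measure ℝ) [IsProbabilityMeasure ν], ZeroOrder.NoiseCondition ν I₀ v₀ →
      ∀ {Ω : Type*} [MeasurableSpace Ω] (P : Measure Ω) [IsProbabilityMeasure P]
        (z₁ : Ω → ZeroOrder.E d) (ξ : ℕ → Ω → ℝ),
        Measurable z₁ → (∀ t < T, Measurable (ξ t)) → (∀ t < T, P.map (ξ t) = ν) →
        iIndepFun (fun t : Fin T => ξ t) P →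
        IndepFun z₁ (fun (ω : Ω) (t : Fin T) => ξ t ω) P →
      ∀ S : ZeroOrder.Strategy d,
        (ENNReal.ofReal (C * min (max α ((T : ℝ) ^ (-(1 / 2) + 1 / β)))
              (min ((d : ℝ) / Real.sqrt T) ((d : ℝ) / α * (T : ℝ) ^ (-((β - 1) / β))))) ≤
          ⨆ f ∈ ZeroOrder.targetClass d α β L G,
            ∫⁻ ω, ENNReal.ofReal
              (f (ZeroOrder.query S f (z₁ ω) (fun t => ξ t ω) (T - 1)) - ⨅ x, f x) ∂P) ∧
        (ENNReal.ofReal (C * min 1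
              (min ((d : ℝ) / (T : ℝ) ^ (1 / β))
                ((d : ℝ) / α ^ 2 * (T : ℝ) ^ (-((β - 1) / β))))) ≤
          ⨆ f ∈ ZeroOrder.targetClass d α β L G,
            ∫⁻ ω, ENNReal.ofReal
              (‖ZeroOrder.query S f (z₁ ω) (fun t => ξ t ω) (T - 1) -
                ZeroOrder.minimizer f‖ ^ 2) ∂P) := by
  -- The constant is chosen before `α`. If this fails, no `α` is admissible and any constant works.
  by_cases hdeg : 0 < G ∧ (β = 2 → 0 < κ)
  swap
  · refine ⟨1, one_pos, fun d T α _ hα hαG hακ => absurd ⟨by linarith, fun h => ?_⟩ hdeg⟩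
    exact pos_of_mul_pos_left (hα.trans_le (hακ h)) hL.le
  obtain ⟨c₀, δ, ρ, hc₀, hc₁, hc₂, hc₃, hδ0, hδ1, hρ0, hρδ, hρL, hρL2, hρv, hρI⟩ :=
    ZeroOrder.exists_constants hL hκ hI₀ hv₀ hdeg.1 hdeg.2
  refine ⟨c₀ * ρ ^ 2 / 256, by positivity, ?_⟩
  intro d T α hT hα hαG hακ ν _ hν Ω _ P _ z₁ ξ hz hξ hlaw hi hzi S
  rcases Nat.eq_zero_or_pos d with rfl | hd
  · have hC : 0 ≤ c₀ * ρ ^ 2 / 256 := by positivity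
    constructor
    · rw [ENNReal.ofReal_of_nonpos]
      · exact zero_le
      · refine mul_nonpos_of_nonneg_of_nonpos hC ((min_le_right _ _).trans ?_)
        simp
    · rw [ENNReal.ofReal_of_nonpos]
      · exact zero_le
      · refine mul_nonpos_of_nonneg_of_nonpos hC ((min_le_right _ _).trans ?_)
        simp
  have hT0 : 0 < T := by omega
  have hTR : (0 : ℝ) < T := by exact_mod_cast hT0
  have hdR : (0 : ℝ) < d := by exact_mod_cast hd
  set τ := (T : ℝ) ^ (-(1 / 2) + 1 / β) with hτ
  set r := (T : ℝ) ^ (-((β - 1) / β)) with hr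
  have hτ0 : 0 < τ := by positivity
  have hr0 : 0 < r := by positivity
  obtain ⟨a, ha⟩ : ∃ a, a = max α (c₀ * τ) := ⟨_, rfl⟩
  have hαa : α ≤ a := ha ▸ le_max_left _ _
  have hτa : c₀ * τ ≤ a := ha ▸ le_max_right _ _
  have ha0 : 0 < a := hα.trans_le hαa
  have hτ1 : τ ≤ 1 := by
    refine Real.rpow_le_one_of_one_le_of_nonpos (by exact_mod_cast hT0) ?_
    have : 1 / β ≤ 1 / 2 := by gcongr
    linarith
  have hcτ : c₀ * τ ≤ c₀ := mul_le_of_le_one_right hc₀.le hτ1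
  -- The gradient is at most `A + δ * a = (1 + 2 * δ) * a`, and `δ ≤ 1/2`.
  have haG : 2 * a ≤ G := by
    rw [ha, mul_max_of_nonneg _ _ (by norm_num)]
    exact max_le hαG.le (by linarith)
  have haL (h : β = 2) : a ≤ κ * L := by
    rw [ha]
    exact max_le (hακ h) (hcτ.trans (hc₃ h))
  obtain ⟨h, hh0, hh1, hhT, hhτ, hhd, hhr⟩ :=
    ZeroOrder.exists_bandwidth (β := β) (a := a) hβ ha0 hd hT0
  have hhβ : 0 < h ^ β := by positivity
  have hhβ1 : h ^ β ≤ 1 := Real.rpow_le_one hh0.le hh1 (by linarith)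
  have hch2 : ρ * h ^ β / h ^ 2 = ρ * h ^ (β - 2) := by
    rw [Real.rpow_sub hh0, Real.rpow_two]
    ring
  have hch1 : ρ * h ^ β / h = ρ * h ^ (β - 1) := by
    rw [Real.rpow_sub_one hh0.ne']
    ring
  have hρδ' : ρ ≤ δ := hρδ.trans (mul_le_of_le_one_right hδ0.le hc₁)
  have hexcess : ρ * h ^ β / h ^ 2 ≤ (1 + δ) * a - a := by
    rw [hch2]
    calc ρ * h ^ (β - 2) ≤ δ * c₀ * τ := by gcongr
      _ = δ * (c₀ * τ) := by ring
      _ ≤ δ * a := by gcongr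
      _ = _ := by ring
  have hgrad : Real.sqrt d * (ρ * h ^ β / h) ≤ δ * a := by
    rw [hch1]
    calc _ = ρ * (Real.sqrt d * h ^ (β - 1)) := by ring
      _ ≤ δ * a := by gcongr
  have hδa : δ * a ≤ 1 / 2 * a := by gcongr
  set A := (1 + δ) * a with hA
  have hA0 : 0 < A := by positivity
  have hA2 : A ≤ 2 * a := by linarith
  have hcont : 2 * (ρ * h ^ β) / h ^ β = 2 * ρ := by field_simp
  have hball : Real.sqrt d * (ρ * h ^ β / (h * A)) ≤ 1 := by
    rw [← div_div, ← mul_div_assoc, div_le_one hA0]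
    exact hgrad.trans (by linarith)
  -- The last query point depends on only `T - 1` observations.
  have hnoise : ((T - 1 : ℕ) : ℝ) * (I₀ * (2 * (ρ * h ^ β)) ^ 2) ≤ 1 / 2 := by
    calc _ ≤ (T : ℝ) * (I₀ * (2 * (ρ * h ^ β)) ^ 2) := by
          gcongr
          exact Nat.sub_le _ _
      _ = I₀ * (2 * ρ) ^ 2 * (T * (h ^ β) ^ 2) := by ring
      _ ≤ I₀ * (2 * ρ) ^ 2 * (T * (1 / T)) := by gcongr
      _ = I₀ * (2 * ρ) ^ 2 := by field_simp
      _ ≤ 1 / 2 := hρI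
  -- The noises from index `T` on need not be measurable; setting them to `0` changes no relevant
  -- query.
  set ξ' : ℕ → Ω → ℝ := fun t => if t < T then ξ t else 0 with hξ'
  have hξeq {t : ℕ} (ht : t < T) : ξ' t = ξ t := if_pos ht
  have hξm (t : ℕ) : Measurable (ξ' t) := by
    by_cases ht : t < T
    · rw [hξeq ht]; exact hξ t ht
    · simp only [hξ', if_neg ht]; exact measurable_const
  have hind (t : ℕ) (ht : t < T - 1) :
      IndepFun (fun ω => (z₁ ω, fun s => if s < t then ξ' s ω else 0)) (ξ' t) P := by
    have htT : t < T := by omega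
    have hpre : (fun ω => (z₁ ω, fun s => if s < t then ξ' s ω else 0)) =
        fun ω => (z₁ ω, fun s => if s < t then ξ s ω else 0) := by
      funext ω
      congr 1
      funext s
      split_ifs with hs
      · rw [hξeq (hs.trans htT)]
      · rfl
    rw [hξeq htT, hpre]
    exact ZeroOrder.indepFun_prefix hz hξ hi hzi htT
  have hquery (f : ZeroOrder.E d → ℝ) (ω : Ω) :
      ZeroOrder.query S f (z₁ ω) (fun t => ξ' t ω) (T - 1) =
        ZeroOrder.query S f (z₁ ω) (fun t => ξ t ω) (T - 1) :=
    ZeroOrder.query_congr S f _ _ fun s hs => by rw [hξeq (by omega : s < T)]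
  have hlaw' (t : ℕ) (ht : t < T - 1) : P.map (ξ' t) = ν := by
    rw [hξeq (by omega), hlaw t (by omega)]
  obtain ⟨hb1, hb2⟩ := ZeroOrder.lower_bounds_of_hardFun (P := P) (n := T - 1) (c := ρ * h ^ β)
    (A := A) (h := h) (α := a) (β := β) (L := L) (G := G) S hz hξm hlaw' hind hν hI₀.le
    (by positivity)
    (lt_of_le_of_lt (ENNReal.ofReal_le_ofReal (by
      have := mul_le_of_le_one_right hρ0.le hhβ1
      linarith)) hρv) hnoise ha0 hA0 hh0 hβ hexcess (by rw [hcont]; exact hρL)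
    (fun h2 => by
      rw [hcont]
      refine le_trans ?_ (hρL2 h2)
      rw [hA]
      gcongr
      exact haL h2)
    (by linarith) hball
  simp only [hquery] at hb1 hb2
  have hsub := ZeroOrder.targetClass_subset (d := d) (β := β) (L := L) (G := G) hαa
  obtain ⟨hr1, hr2⟩ := ZeroOrder.rates_le (d := d) hβ hT0 hα hc₀ hc₁ ha
  -- Here `128 = 4 ^ 2 * 8`, from `A ≤ 2 * a` and the `d / 8` of Assouad's bound. The factor `a / 2`
  -- of strong convexity then gives 256.
  have hsize : ρ ^ 2 / 128 * min 1 (d / a ^ 2 * r) ≤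
      (ρ * h ^ β / (2 * (h * A))) ^ 2 * (d / 8) := by
    have hmin : min 1 (d / a ^ 2 * r) = d / a ^ 2 * (h ^ (β - 1)) ^ 2 := by
      rw [hhr, mul_min_of_nonneg _ _ (by positivity)]
      congr 1
      field_simp
    have hfrac : ρ * h ^ β / (2 * (h * A)) = ρ * h ^ (β - 1) / (2 * A) := by
      rw [← hch1]
      field_simp
    rw [hmin, hfrac]
    calc _ = (ρ * h ^ (β - 1) / (2 * (2 * a))) ^ 2 * (d / 8) := by
          field_simp
          norm_num
      _ ≤ _ := by gcongr
  constructor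
  · refine le_trans (ENNReal.ofReal_le_ofReal ?_) (hb1.trans (biSup_mono fun f hf => hsub hf))
    calc _ = ρ ^ 2 / 256 * (c₀ * min (max α τ) (min (d / Real.sqrt T) (d / α * r))) := by ring
      _ ≤ ρ ^ 2 / 256 * min a (d / a * r) := by gcongr
      _ = a / 2 * (ρ ^ 2 / 128 * min 1 (d / a ^ 2 * r)) := by
          have : min a (d / a * r) = a * min 1 (d / a ^ 2 * r) := by
            rw [mul_min_of_nonneg _ _ ha0.le]
            congr 1
            · ring
            · field_simp
          rw [this]
          ring
      _ ≤ _ := by gcongr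
  · refine le_trans (ENNReal.ofReal_le_ofReal ?_) (hb2.trans (biSup_mono fun f hf => hsub hf))
    refine le_trans ?_ hsize
    have hmin0 : 0 ≤ min 1 (d / a ^ 2 * r) := by positivity
    calc _ ≤ c₀ * ρ ^ 2 / 256 * min 1 (d / a ^ 2 * r) := by gcongr
      _ ≤ ρ ^ 2 / 128 * min 1 (d / a ^ 2 * r) := by
          refine mul_le_mul_of_nonneg_right ?_ hmin0
          nlinarith [sq_nonneg ρ]
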